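/- Let $n\in\mathbb N$ and let $\Omega\subset\mathbb R^n$ be measurable with $|\Omega|<\infty$. For a measurable $f:\Omega\to\mathbb R$ let $f^*(s)=\inf\{a\ge 0: |\{x\in\Omega:|f(x)|>a\}|\le s\}$, and for $a\in\mathbb R$ put $$N_{a,\tau}(f)=\Big(\int_0^1\big(t^{a}f^*(t|\Omega|)\big)^\tau\,\frac{dt}{t}\Big)^{1/\tau}\ (0<\tau<\infty),\qquad N_{a,\infty}(f)=\sup_{0<t<1}t^{a}f^*(t|\Omega|).$$ For $0<p<\infty$, $0<\tau\le\infty$ and $\theta\in\mathbb R$ the grand Lorentz space $GL^{\theta}_{p,\tau}(\Omega)$ consists of the measurable $f:\Omega\to\mathbb R$ with $\|f\|_{GL^\theta_{p,\tau}(\Omega)}<\infty$, where $$\|f\|_{GL^\theta_{p,\tau}(\Omega)}=\sup_{0<\varepsilon<1}\varepsilon^\theta N_{\frac1p+\varepsilon,\tau}(f)\ \text{ if }\theta\ge 0,\qquad \|f\|_{GL^\theta_{p,\tau}(\Omega)}=\inf_{0<\varepsilon<1/p}\varepsilon^\theta N_{\frac1p-\varepsilon,\tau}(f)\ \text{ if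 }\theta<0.$$ For $f,g$ on $\Omega$ let $f*g(y)=\int_\Omega f(x)g(y-x)\,dx$ for $y\in\Omega$, where $g$ is extended by zero outside $\Omega$. **Theorem (O'Neil-type inequality).** Let $1<p<q<\infty$, $\frac1r=1+\frac1q-\frac1p$, $0<\tau\le\infty$ and $\theta,\theta_0,\theta_1\ge 0$. In each of the estimates below, whenever $f$ and $g$ belong to the spaces on the right-hand side, the integral defining $f*g(y)$ converges absolutely for almost every $y\in\Omega$, $f*g$ belongs to the space on the left-hand side, and the estimate holds with a constant $C>0$ that does not depend on $f$ and $g$. If $\theta=\theta_1+\theta_0$, then $$\|f*g\|_{GL^{\theta_1}_{q,\tau}(\Omega)}\le C\,\|f\|_{GL^{-\theta_0}_{p,\tau}(\Omega)}\|g\|_{GL^{\theta}_{r,\infty}(\Omega)}\quad\text{and}\quad \|f*g\|_{GL^{-\theta_1}_{q,\tau}(\Omega)}\le C\,\|f\|_{GL^{\theta_0}_{p,\tau}(\Omega)}\|g\|_{GL^{-\theta}_{r,\infty}(\Omega)}.$$ If $\theta=\theta_1-\theta_0$, then $$\|f*g\|_{GL^{\theta_1}_{q,\tau}(\Omega)}\le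 C\,\|f\|_{GL^{\theta_0}_{p,\tau}(\Omega)}\|g\|_{GL^{\theta}_{r,\infty}(\Omega)}\quad\text{and}\quad \|f*g\|_{GL^{-\theta_1}_{q,\tau}(\Omega)}\le C\,\|f\|_{GL^{-\theta_0}_{p,\tau}(\Omega)}\|g\|_{GL^{-\theta}_{r,\infty}(\Omega)}.$$ -/

import Mathlib

open MeasureTheory Set
open scoped ENNReal NNReal

/-- The decreasing rearrangement `f^*(s) = inf {a ≥ 0 : μ {x : |f x| > a} ≤ s}`. -/
noncomputable def decRearrangement {α : Type*} [MeasurableSpace α] (μ : Measure α) (f : α → ℝ)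
    (s : ℝ≥0∞) : ℝ≥0∞ :=
  sInf {a : ℝ≥0∞ | μ {x | a < ‖f x‖ₑ} ≤ s}

/-- The functional `(∫_0^1 (t^a f^*(t|Ω|))^q dt/t)^(1/q)`, respectively
`sup_{0<t<1} t^a f^*(t|Ω|)` when `q = ∞`, where `f` is regarded as a function on `Ω`. -/
noncomputable def lorentzFunctional {n : ℕ} (Ω : Set (EuclideanSpace ℝ (Fin n))) (a : ℝ)
    (q : ℝ≥0∞) (f : EuclideanSpace ℝ (Fin n) → ℝ) : ℝ≥0∞ :=
  if q = ∞ then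
    ⨆ t ∈ Ioo (0 : ℝ) 1, ENNReal.ofReal (t ^ a) *
      decRearrangement (volume.restrict Ω) f (ENNReal.ofReal t * volume Ω)
  else
    (∫⁻ t in Ioo (0 : ℝ) 1, (ENNReal.ofReal (t ^ a) *
      decRearrangement (volume.restrict Ω) f (ENNReal.ofReal t * volume Ω)) ^ q.toReal *
        ENNReal.ofReal (1 / t)) ^ (1 / q.toReal)

/-- The quasinorm of the grand Lorentz space `GL^θ_{p,q}(Ω)`, with values in `[0, ∞]`. Here
`p⁻¹.toReal` is the real number `1/p`, read as `0` when `p = ∞`. -/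
noncomputable def grandLorentzNorm {n : ℕ} (Ω : Set (EuclideanSpace ℝ (Fin n))) (θ : ℝ)
    (p q : ℝ≥0∞) (f : EuclideanSpace ℝ (Fin n) → ℝ) : ℝ≥0∞ :=
  if 0 ≤ θ then
    ⨆ ε ∈ Ioo (0 : ℝ) 1, ENNReal.ofReal (ε ^ θ) * lorentzFunctional Ω (p⁻¹.toReal + ε) q f
  else
    ⨅ ε ∈ Ioo (0 : ℝ) p⁻¹.toReal,
      ENNReal.ofReal (ε ^ θ) * lorentzFunctional Ω (p⁻¹.toReal - ε) q f

/-- Membership in `GL^θ_{p,q}(Ω)`: only the values of `f` on `Ω` matter. -/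
def MemGrandLorentz {n : ℕ} (Ω : Set (EuclideanSpace ℝ (Fin n))) (θ : ℝ) (p q : ℝ≥0∞)
    (f : EuclideanSpace ℝ (Fin n) → ℝ) : Prop :=
  AEMeasurable f (volume.restrict Ω) ∧ grandLorentzNorm Ω θ p q f < ∞

/-- The convolution over `Ω`, `(f * g)(y) = ∫_Ω f(x) g(y - x) dx`, where `g`, a function on `Ω`,
is extended by zero outside `Ω`. -/
noncomputable def convOn {n : ℕ} (Ω : Set (EuclideanSpace ℝ (Fin n)))
    (f g : EuclideanSpace ℝ (Fin n) → ℝ) (y : EuclideanSpace ℝ (Fin n)) : ℝ :=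
  ∫ x in Ω, f x * Ω.indicator g (y - x)

/-- The estimate
`‖f * g‖_{GL^γ_{q,τ}(Ω)} ≤ C ‖f‖_{GL^α_{p,τ}(Ω)} ‖g‖_{GL^β_{r,∞}(Ω)}` with a constant `C`
independent of `f` and `g`. It includes that the integral defining `f * g` converges absolutely
at almost every point of `Ω` and that `f * g` belongs to the target space. -/
def GrandConvEstimate {n : ℕ} (Ω : Set (EuclideanSpace ℝ (Fin n))) (p q r : ℝ) (τ : ℝ≥0∞)
    (α β γ : ℝ) : Prop :=
  ∃ C : ℝ≥0, 0 < C ∧ ∀ f g : EuclideanSpace ℝ (Fin n) → ℝ,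
    MemGrandLorentz Ω α (ENNReal.ofReal p) τ f →
    MemGrandLorentz Ω β (ENNReal.ofReal r) ∞ g →
      (∀ᵐ y ∂(volume.restrict Ω), IntegrableOn (fun x => f x * Ω.indicator g (y - x)) Ω) ∧
      MemGrandLorentz Ω γ (ENNReal.ofReal q) τ (convOn Ω f g) ∧
      grandLorentzNorm Ω γ (ENNReal.ofReal q) τ (convOn Ω f g) ≤
        C * grandLorentzNorm Ω α (ENNReal.ofReal p) τ f *
          grandLorentzNorm Ω β (ENNReal.ofReal r) ∞ g

/-! The proof separates a classical inequality, uniform in its exponents, from an optimization over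
shifts of those exponents.

The classical part is O'Neil's inequality N_{a+b-1,τ}(f*g) ≤ K N_{a,τ}(f) N_{b,∞}(g), where K
depends only on Ω, τ and σ as long as a, b ≤ 1-σ and a+b-1 ≥ σ (`exists_lorentzQuasinorm_lconv_le`).
Its pointwise form `rearr_lconv_le` comes from cutting |f| at the level f^*(s). The part above is
integrable, so its convolution obeys a weak type bound; the part below has a uniformly bounded
convolution. Both bounds use only that the integral of |g| over E is at most D|E|^(1-b), which
follows from the weak bound on g^*. Integrals of f^* are replaced by dyadic sums of f^*(2^k s), k of
either sign, so that Hardy's inequality becomes the boundedness of geometrically weighted dilations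
in L^τ(dt/t) (`exists_logNorm_dyadic_le`). This also covers τ < 1.

Since 1/p + 1/r - 1 = 1/q, taking a = 1/p + x and b = 1/r + y controls f*g at the exponent 1/q + x +
y. A grand quasinorm is a supremum over positive shifts or an infimum over negative ones, with
weight ε^θ. Each of the four estimates amounts to a choice of x and y for which the powers of the
shifts balance (`grandProductEstimates`). The scales N are antitone in the exponent because t < 1,
so only shifts of size at most σ matter, which is where K is uniform. -/

/-- The decreasing rearrangement of a function with values in `[0, ∞]`. -/
noncomputable def rearr {α : Type*} [MeasurableSpace α] (μ : Measure α) (u : α → ℝ≥0∞)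
    (s : ℝ≥0∞) : ℝ≥0∞ :=
  sInf {a : ℝ≥0∞ | μ {x | a < u x} ≤ s}

/-! ### Dyadic level decompositions by means of the rearrangement. -/

section Rearrangement

variable {α : Type*} [MeasurableSpace α] {μ : Measure α} {u v : α → ℝ≥0∞} {s t a : ℝ≥0∞}

theorem rearr_le_of_measure_le (h : μ {x | a < u x} ≤ s) : rearr μ u s ≤ a :=
  sInf_le h

theorem measure_lt_le_of_rearr_lt (h : rearr μ u s < a) : μ {x | a < u x} ≤ s := by
  obtain ⟨b, hb, hba⟩ := sInf_lt_iff.1 h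
  exact (measure_mono fun x hx => hba.trans hx).trans hb

/-- The infimum defining the rearrangement is attained: the superlevel sets increase to this one as
the level decreases to u^*(s). -/
theorem measure_rearr_lt_le : μ {x | rearr μ u s < u x} ≤ s := by
  rcases eq_or_ne (rearr μ u s) ∞ with h | h
  · simp [h]
  obtain ⟨b, hb, hb', hlim⟩ := exists_seq_strictAnti_tendsto' (lt_top_iff_ne_top.2 h)
  have hU : {x | rearr μ u s < u x} = ⋃ n, {x | b n < u x} := by
    ext x
    simp only [mem_ofPred_eq, mem_iUnion]
    refine ⟨fun hx => ?_, fun ⟨n, hn⟩ => (hb' n).1.trans hn⟩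
    exact (hlim.eventually_lt_const hx).exists
  have hmono : Monotone fun n => {x | b n < u x} :=
    fun m n hmn x hx => (hb.antitone hmn).trans_lt hx
  rw [hU, hmono.measure_iUnion]
  exact iSup_le fun n => measure_lt_le_of_rearr_lt (hb' n).1

theorem rearr_antitone : Antitone (rearr μ u) :=
  fun _ _ hst => sInf_le_sInf fun _ ha => le_trans ha hst

theorem rearr_mono (h : ∀ x, u x ≤ v x) : rearr μ u s ≤ rearr μ v s :=
  sInf_le_sInf fun _ ha => (measure_mono fun x hx => lt_of_lt_of_le hx (h x)).trans ha

theorem rearr_congr_ae (h : u =ᵐ[μ] v) : rearr μ u s = rearr μ v s := by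
  unfold rearr
  congr 1
  ext a
  have : μ {x | a < u x} = μ {x | a < v x} := measure_congr
    (Filter.eventuallyEq_set.2 (by filter_upwards [h] with x hx; simp [hx]))
  simp [this]

theorem rearr_eq_zero (h : μ {x | 0 < u x} ≤ s) : rearr μ u s = 0 :=
  le_antisymm (rearr_le_of_measure_le h) bot_le

theorem rearr_restrict {Ω : Set α} (hΩ : MeasurableSet Ω) :
    rearr (μ.restrict Ω) u s = rearr μ (Ω.indicator u) s := by
  unfold rearr
  congr 1
  ext a
  have : {x | a < u x} ∩ Ω = {x | a < Ω.indicator u x} := by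
    ext x
    by_cases hx : x ∈ Ω <;> simp [hx]
  simp only [mem_ofPred_eq, Measure.restrict_apply' hΩ, this]

/-- The levels u^*(2^{-k} s) increase with k, and the points above all of them form a null set. At
any other point, the first level that is at least u x contributes a term of the sum that already
dominates u x. -/
theorem ae_le_tsum_of_rearr_lt (hs : s ≠ ∞) :
    ∀ᵐ x ∂μ, rearr μ u s < u x →
      u x ≤ ∑' k : ℕ, {x | rearr μ u (2⁻¹ ^ k * s) < u x}.indicator
        (fun _ => rearr μ u (2⁻¹ ^ (k + 1) * s)) x := by
  have hnull : μ (⋂ k : ℕ, {x | rearr μ u (2⁻¹ ^ k * s) < u x}) = 0 := by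
    have hlim : Filter.Tendsto (fun k : ℕ => (2⁻¹ : ℝ≥0∞) ^ k * s) Filter.atTop (nhds 0) := by
      have := ENNReal.Tendsto.mul_const
        (ENNReal.tendsto_pow_atTop_nhds_zero_of_lt_one (r := 2⁻¹) (by simp)) (Or.inr hs)
      simpa using this
    refine le_antisymm (ge_of_tendsto' hlim fun k => ?_) bot_le
    exact (measure_mono (iInter_subset _ k)).trans measure_rearr_lt_le
  have hae : ∀ᵐ x ∂μ, x ∉ ⋂ k : ℕ, {x | rearr μ u (2⁻¹ ^ k * s) < u x} :=
    measure_eq_zero_iff_ae_notMem.1 hnull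
  filter_upwards [hae] with x hx hxs
  simp only [mem_iInter, mem_ofPred_eq, not_forall, not_lt] at hx
  classical
  obtain ⟨k, hk⟩ : ∃ k, Nat.find hx = k + 1 := by
    refine Nat.exists_eq_succ_of_ne_zero fun h0 => ?_
    have := Nat.find_spec hx
    rw [h0] at this
    simp only [pow_zero, one_mul] at this
    exact absurd hxs this.not_gt
  have h1 := Nat.find_spec hx
  have h2 := Nat.find_min hx (m := k) (by omega)
  rw [hk] at h1
  refine le_trans ?_ (ENNReal.le_tsum k)
  rw [indicator_of_mem (s := {x | rearr μ u (2⁻¹ ^ k * s) < u x}) (not_le.1 h2)]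
  exact h1

theorem lintegral_rearr_lt_le (hu : Measurable u) (hs : s ≠ ∞) :
    ∫⁻ x in {x | rearr μ u s < u x}, u x ∂μ ≤
      ∑' k : ℕ, 2⁻¹ ^ k * s * rearr μ u (2⁻¹ ^ (k + 1) * s) := by
  have hm : ∀ c, MeasurableSet {x | c < u x} := fun c => measurableSet_lt measurable_const hu
  calc ∫⁻ x in {x | rearr μ u s < u x}, u x ∂μ
      ≤ ∫⁻ x in {x | rearr μ u s < u x}, ∑' k : ℕ, {x | rearr μ u (2⁻¹ ^ k * s) < u x}.indicator
        (fun _ => rearr μ u (2⁻¹ ^ (k + 1) * s)) x ∂μ :=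
        setLIntegral_mono_ae' (hm _) (ae_le_tsum_of_rearr_lt hs)
    _ ≤ ∫⁻ x, ∑' k : ℕ, {x | rearr μ u (2⁻¹ ^ k * s) < u x}.indicator
        (fun _ => rearr μ u (2⁻¹ ^ (k + 1) * s)) x ∂μ := setLIntegral_le_lintegral _ _
    _ = ∑' k : ℕ, rearr μ u (2⁻¹ ^ (k + 1) * s) * μ {x | rearr μ u (2⁻¹ ^ k * s) < u x} := by
        rw [lintegral_tsum fun k => (measurable_const.indicator (hm _)).aemeasurable]
        simp_rw [lintegral_indicator_const (hm _)]
    _ ≤ _ := ENNReal.tsum_le_tsum fun k => by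
        rw [mul_comm]
        gcongr
        exact measure_rearr_lt_le

/-- The same search with levels going down. It ends because the support has finite measure, so
u^*(2^k s) = 0 for large k. -/
theorem le_tsum_of_le_rearr (hs : s ≠ 0) (hsupp : μ {x | 0 < u x} ≠ ∞) {x : α}
    (hx : u x ≤ rearr μ u s) :
    u x ≤ ∑' k : ℕ, {x | rearr μ u (2 ^ (k + 1) * s) < u x}.indicator
        (fun _ => rearr μ u (2 ^ k * s)) x := by
  rcases eq_or_ne (u x) 0 with h0 | h0
  · simp [h0]
  have hex : ∃ k : ℕ, rearr μ u (2 ^ k * s) < u x := by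
    obtain ⟨k, hk⟩ := ENNReal.exists_nat_mul_gt hs hsupp
    refine ⟨k, ?_⟩
    rw [rearr_eq_zero]
    · exact pos_iff_ne_zero.2 h0
    · refine hk.le.trans ?_
      gcongr
      exact_mod_cast k.lt_two_pow_self.le
  classical
  obtain ⟨k, hk⟩ : ∃ k, Nat.find hex = k + 1 := by
    refine Nat.exists_eq_succ_of_ne_zero fun h0 => ?_
    have := Nat.find_spec hex
    rw [h0] at this
    simp only [pow_zero, one_mul] at this
    exact absurd hx this.not_ge
  have h1 := Nat.find_spec hex
  have h2 := Nat.find_min hex (m := k) (by omega)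
  rw [hk] at h1
  refine le_trans ?_ (ENNReal.le_tsum k)
  rw [indicator_of_mem (s := {x | rearr μ u (2 ^ (k + 1) * s) < u x}) h1]
  exact not_lt.1 h2

/-- Integrals over sets of given measure are controlled by the rearrangement. -/
theorem setLIntegral_le_rearr (hu : Measurable u) {E : Set α}  (hE : μ E ≠ ∞) :
    ∫⁻ x in E, u x ∂μ ≤
      μ E * rearr μ u (μ E) + ∑' k : ℕ, 2⁻¹ ^ k * μ E * rearr μ u (2⁻¹ ^ (k + 1) * μ E) := by
  set A := {x | rearr μ u (μ E) < u x} with hA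
  have hAm : MeasurableSet A := measurableSet_lt measurable_const hu
  calc ∫⁻ x in E, u x ∂μ
      ≤ ∫⁻ x in E, (rearr μ u (μ E) + A.indicator u x) ∂μ := by
        refine lintegral_mono fun x => ?_
        by_cases hx : x ∈ A
        · simp [hx]
        · simpa [hx] using not_lt.1 hx
    _ = rearr μ u (μ E) * μ E + ∫⁻ x in E, A.indicator u x ∂μ := by
        rw [lintegral_add_left measurable_const, setLIntegral_const]
    _ ≤ _ := by
        rw [mul_comm]
        gcongr
        refine (setLIntegral_le_lintegral _ _).trans ?_
        rw [lintegral_indicator hAm]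
        exact lintegral_rearr_lt_le hu hE

end Rearrangement

/-! ### O'Neil's inequality for rearrangements, in dyadic form. -/

section Convolution

variable {G : Type*} [AddCommGroup G] [MeasurableSpace G] {μ : Measure G}
  {u v : G → ℝ≥0∞} {D s : ℝ≥0∞} {β : ℝ}

/-- The convolution of two functions with values in `[0, ∞]`. -/
noncomputable def lconv (μ : Measure G) (u v : G → ℝ≥0∞) (y : G) : ℝ≥0∞ :=
  ∫⁻ x, u x * v (y - x) ∂μ

theorem measurable_lconv [MeasurableAdd₂ G] [MeasurableNeg G] [SFinite μ]
    (hu : Measurable u) (hv : Measurable v) :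
    Measurable (lconv μ u v) := by
  have : Measurable fun z : G × G => u z.2 * v (z.1 - z.2) :=
    (hu.comp measurable_snd).mul (hv.comp (measurable_fst.sub measurable_snd))
  exact this.lintegral_prod_right'

theorem setLIntegral_comp_sub_left_le [MeasurableAdd₂ G] [MeasurableNeg G] [μ.IsAddLeftInvariant]
    [μ.IsNegInvariant]
    (hD : ∀ E, MeasurableSet E → μ E ≠ ∞ → ∫⁻ x in E, v x ∂μ ≤ D * μ E ^ β)
    {A : Set G} (hA : MeasurableSet A) (hA' : μ A ≠ ∞) (y : G) :
    ∫⁻ x in A, v (y - x) ∂μ ≤ D * μ A ^ β := by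
  have hmp := Measure.measurePreserving_sub_left μ y
  have hm : MeasurableSet ((fun x => y - x) ⁻¹' A) := hmp.measurable hA
  have hμ : μ ((fun x => y - x) ⁻¹' A) = μ A := hmp.measure_preimage hA.nullMeasurableSet
  have h := hD _ hm (by rwa [hμ])
  rw [hμ] at h
  convert h using 1
  rw [← lintegral_indicator hA, ← lintegral_indicator hm, ← lintegral_sub_left_eq_self _ y]
  refine lintegral_congr fun x => ?_
  by_cases hx : y - x ∈ A
  · rw [indicator_of_mem hx, indicator_of_mem (by simpa using hx)]
    simp
  · rw [indicator_of_notMem hx, indicator_of_notMem (by simpa using hx)]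

theorem setLIntegral_comp_sub_right_le [MeasurableAdd₂ G] [μ.IsAddLeftInvariant]
    (hD : ∀ E, MeasurableSet E → μ E ≠ ∞ → ∫⁻ x in E, v x ∂μ ≤ D * μ E ^ β)
    {A : Set G} (hA : MeasurableSet A) (hA' : μ A ≠ ∞) (x : G) :
    ∫⁻ y in A, v (y - x) ∂μ ≤ D * μ A ^ β := by
  have hmp := measurePreserving_add_right μ x
  have hm : MeasurableSet ((fun z => z + x) ⁻¹' A) := hmp.measurable hA
  have hμ : μ ((fun z => z + x) ⁻¹' A) = μ A := hmp.measure_preimage hA.nullMeasurableSet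
  have h := hD _ hm (by rwa [hμ])
  rw [hμ] at h
  convert h using 1
  rw [← lintegral_indicator hA, ← lintegral_indicator hm, ← lintegral_add_right_eq_self _ x]
  refine lintegral_congr fun z => ?_
  by_cases hx : z + x ∈ A
  · rw [indicator_of_mem hx, indicator_of_mem (by simpa using hx)]
    simp
  · rw [indicator_of_notMem hx, indicator_of_notMem (by simpa using hx)]

variable [MeasurableAdd₂ G] [MeasurableNeg G] [μ.IsAddLeftInvariant]

/-- Weak type bound for the convolution of an integrable function. -/
theorem measure_lt_lconv_le [SFinite μ] (hu : Measurable u) (hv : Measurable v)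
    (hβ : β ≤ 1)
    (hD : ∀ E, MeasurableSet E → μ E ≠ ∞ → ∫⁻ x in E, v x ∂μ ≤ D * μ E ^ β)
    {Ω : Set G} (hΩ : MeasurableSet Ω) (hΩ' : μ Ω ≠ ∞) {a : ℝ≥0∞}
    (ha : D * s ^ (β - 1) * ∫⁻ x, u x ∂μ < a) :
    μ.restrict Ω {y | a < lconv μ u v y} ≤ s := by
  have hEm : MeasurableSet {y | a < lconv μ u v y} :=
    measurableSet_lt measurable_const (measurable_lconv hu hv)
  rw [Measure.restrict_apply hEm]
  set E := {y | a < lconv μ u v y} ∩ Ω with hE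
  have hE' : μ E ≠ ∞ := measure_ne_top_of_subset inter_subset_right hΩ'
  have hEM : MeasurableSet E := hEm.inter hΩ
  -- If E had measure above s, integrating a over E and applying Tonelli would give a ≤ D |E|^(β-1)
  -- ∫u. As β ≤ 1, replacing |E| by s only increases the right side, against the choice of a.
  by_contra! hlt
  have hE0 : μ E ≠ 0 := (bot_le.trans_lt hlt).ne'
  have h1 : a * μ E ≤ D * μ E ^ β * ∫⁻ x, u x ∂μ := by
    calc a * μ E = ∫⁻ _ in E, a ∂μ := by rw [setLIntegral_const]
      _ ≤ ∫⁻ y in E, lconv μ u v y ∂μ :=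
        setLIntegral_mono' hEM fun y hy => le_of_lt hy.1
      _ = ∫⁻ x, ∫⁻ y in E, u x * v (y - x) ∂μ ∂μ := by
        unfold lconv
        refine lintegral_lintegral_swap ?_
        exact ((hu.comp measurable_snd).mul
          (hv.comp (measurable_fst.sub measurable_snd))).aemeasurable
      _ = ∫⁻ x, u x * ∫⁻ y in E, v (y - x) ∂μ ∂μ := by
        refine lintegral_congr fun x => ?_
        exact lintegral_const_mul _ (hv.comp (measurable_id.sub_const x))
      _ ≤ ∫⁻ x, u x * (D * μ E ^ β) ∂μ := by
        refine lintegral_mono fun x => ?_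
        gcongr
        exact setLIntegral_comp_sub_right_le hD hEM hE' x
      _ = _ := by rw [lintegral_mul_const _ hu, mul_comm]
  have h2 : a ≤ D * μ E ^ (β - 1) * ∫⁻ x, u x ∂μ := by
    have := ENNReal.le_div_iff_mul_le (Or.inl hE0) (Or.inl hE') |>.2 h1
    refine this.trans_eq ?_
    rw [ENNReal.rpow_sub _ _ hE0 hE', ENNReal.rpow_one]
    simp only [div_eq_mul_inv]
    ring
  refine absurd (h2.trans ?_) ha.not_ge
  gcongr D * ?_ * _
  rw [← neg_sub, ENNReal.rpow_neg, ENNReal.rpow_neg]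
  exact ENNReal.inv_le_inv.2 (ENNReal.rpow_le_rpow hlt.le (by linarith))

variable [μ.IsNegInvariant]

/-- Pointwise bound for the convolution of the part of `u` below the level `u^*(s)`. -/
theorem lconv_lower_part_le (hu : Measurable u) (hv : Measurable v) (hβ : 0 ≤ β)
    (hD : ∀ E, MeasurableSet E → μ E ≠ ∞ → ∫⁻ x in E, v x ∂μ ≤ D * μ E ^ β)
    (hsupp : μ {x | 0 < u x} ≠ ∞) (hs : s ≠ 0) (hs' : s ≠ ∞) (y : G) :
    lconv μ ({x | u x ≤ rearr μ u s}.indicator u) v y ≤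
      ∑' k : ℕ, rearr μ u (2 ^ k * s) * (D * (2 ^ (k + 1) * s) ^ β) := by
  have hm : ∀ c, MeasurableSet {x | c < u x} := fun c => measurableSet_lt measurable_const hu
  have hvy : Measurable fun x => v (y - x) := hv.comp (measurable_id.const_sub y)
  calc lconv μ ({x | u x ≤ rearr μ u s}.indicator u) v y
      ≤ ∫⁻ x, ∑' k : ℕ, rearr μ u (2 ^ k * s) *
          {x | rearr μ u (2 ^ (k + 1) * s) < u x}.indicator (fun x => v (y - x)) x ∂μ := by
        refine lintegral_mono fun x => ?_
        by_cases hx : u x ≤ rearr μ u s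
        · rw [indicator_of_mem (s := {x | u x ≤ rearr μ u s}) hx]
          refine (mul_le_mul_left (le_tsum_of_le_rearr hs hsupp hx) _).trans_eq ?_
          rw [← ENNReal.tsum_mul_right]
          refine tsum_congr fun k => ?_
          by_cases hk : x ∈ {x | rearr μ u (2 ^ (k + 1) * s) < u x} <;> simp [hk]
        · rw [indicator_of_notMem (s := {x | u x ≤ rearr μ u s}) hx]
          simp
    _ = ∑' k : ℕ, rearr μ u (2 ^ k * s) *
          ∫⁻ x in {x | rearr μ u (2 ^ (k + 1) * s) < u x}, v (y - x) ∂μ := by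
        rw [lintegral_tsum fun k => ((hvy.indicator (hm _)).const_mul _).aemeasurable]
        refine tsum_congr fun k => ?_
        rw [lintegral_const_mul _ (hvy.indicator (hm _)), lintegral_indicator (hm _)]
    _ ≤ _ := by
        refine ENNReal.tsum_le_tsum fun k => ?_
        have hk : μ {x | rearr μ u (2 ^ (k + 1) * s) < u x} ≤ 2 ^ (k + 1) * s :=
          measure_rearr_lt_le
        gcongr
        refine (setLIntegral_comp_sub_left_le hD (hm _) ?_ y).trans ?_
        · exact ne_top_of_le_ne_top (ENNReal.mul_ne_top (by simp) hs') hk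
        · gcongr

/-- O'Neil's inequality in dyadic form. -/
theorem rearr_lconv_le [SFinite μ] (hu : Measurable u) (hv : Measurable v)
    (hβ : 0 ≤ β) (hβ' : β ≤ 1)
    (hD : ∀ E, MeasurableSet E → μ E ≠ ∞ → ∫⁻ x in E, v x ∂μ ≤ D * μ E ^ β)
    (hsupp : μ {x | 0 < u x} ≠ ∞) {Ω : Set G} (hΩ : MeasurableSet Ω) (hΩ' : μ Ω ≠ ∞)
    (hs : s ≠ 0) (hs' : s ≠ ∞) :
    rearr (μ.restrict Ω) (lconv μ u v) s ≤
      D * s ^ (β - 1) * (∑' k : ℕ, 2⁻¹ ^ k * s * rearr μ u (2⁻¹ ^ (k + 1) * s)) +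
      ∑' k : ℕ, rearr μ u (2 ^ k * s) * (D * (2 ^ (k + 1) * s) ^ β) := by
  have hm : MeasurableSet {x | rearr μ u s < u x} := measurableSet_lt measurable_const hu
  set u₁ := {x | rearr μ u s < u x}.indicator u with hu₁
  set u₂ := {x | u x ≤ rearr μ u s}.indicator u with hu₂
  have hu₁m : Measurable u₁ := hu.indicator hm
  have hsplit : ∀ y, lconv μ u v y = lconv μ u₁ v y + lconv μ u₂ v y := fun y => by
    unfold lconv
    have hm₁ : Measurable fun x => u₁ x * v (y - x) :=
      hu₁m.mul (hv.comp (measurable_id.const_sub y))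
    rw [← lintegral_add_left hm₁]
    refine lintegral_congr fun x => ?_
    rw [← add_mul]
    congr 1
    by_cases hx : rearr μ u s < u x
    · simp [hu₁, hu₂, hx]
    · simp [hu₁, hu₂, not_lt.1 hx]
  have hint : ∫⁻ x, u₁ x ∂μ ≤ ∑' k : ℕ, 2⁻¹ ^ k * s * rearr μ u (2⁻¹ ^ (k + 1) * s) := by
    rw [hu₁, lintegral_indicator hm]
    exact lintegral_rearr_lt_le hu hs'
  -- For c above the right side, the lower part contributes at most B pointwise, so u * v > c forces
  -- u₁ * v > c - B, and c - B still exceeds the weak type threshold S.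
  refine le_of_forall_gt_imp_ge_of_dense fun c hc => ?_
  set S := D * s ^ (β - 1) * (∑' k : ℕ, 2⁻¹ ^ k * s * rearr μ u (2⁻¹ ^ (k + 1) * s))
  set B := ∑' k : ℕ, rearr μ u (2 ^ k * s) * (D * (2 ^ (k + 1) * s) ^ β) with hB
  have hlt : S < c - B := by
    rwa [lt_tsub_iff_right]
  refine rearr_le_of_measure_le (le_trans (measure_mono fun y hy => ?_)
    (measure_lt_lconv_le (u := u₁) hu₁m hv hβ' hD hΩ hΩ' (a := c - B) ?_))
  · have h2 : lconv μ u₂ v y ≤ B := lconv_lower_part_le hu hv hβ hD hsupp hs hs' y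
    have hy' : c < lconv μ u v y := hy
    rw [hsplit] at hy'
    have h3 : c < lconv μ u₁ v y + B := hy'.trans_le (by gcongr)
    have hcB : B ≠ ∞ := fun h => by
      rw [h] at hlt
      simp at hlt
    exact (ENNReal.sub_lt_iff_lt_right hcB (le_trans le_add_self hc.le)).2 h3
  · exact lt_of_le_of_lt (mul_le_mul_right hint _) hlt

/-- This and the next lemma turn the gaps in the exponents into the common decay 2^{-σk} of the
dyadic terms, which makes all constants uniform. -/
theorem half_pow_mul_rpow_le {b σ : ℝ} (hσ : 0 ≤ σ) (hσb : b ≤ 1 - σ) (k : ℕ) :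
    (2⁻¹ : ℝ≥0∞) ^ k * (2⁻¹ ^ (k + 1)) ^ (-b) ≤ 2 * ((2 : ℝ≥0∞) ^ (-σ)) ^ k := by
  simp only [← ENNReal.rpow_natCast, ← ENNReal.rpow_neg_one (2 : ℝ≥0∞), ← ENNReal.rpow_mul]
  rw [← ENNReal.rpow_add _ _ (by simp) (by simp)]
  nth_rewrite 2 [← ENNReal.rpow_one 2]
  rw [← ENNReal.rpow_add _ _ (by simp) (by simp)]
  refine ENNReal.rpow_le_rpow_of_exponent_le (by norm_num) ?_
  push_cast
  nlinarith [(Nat.cast_nonneg k : (0 : ℝ) ≤ k)]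

theorem two_pow_rpow_le {a b σ : ℝ} (hb : 0 ≤ b) (hσ : σ ≤ a + b - 1) (k : ℕ) :
    ((2 : ℝ≥0∞) ^ (k + 1)) ^ (1 - b) ≤ 2 * ((2 : ℝ≥0∞) ^ (-σ)) ^ k * (2 ^ k) ^ a := by
  simp only [← ENNReal.rpow_natCast, ← ENNReal.rpow_mul]
  nth_rewrite 2 [← ENNReal.rpow_one 2]
  rw [← ENNReal.rpow_add _ _ (by simp) (by simp), ← ENNReal.rpow_add _ _ (by simp) (by simp)]
  refine ENNReal.rpow_le_rpow_of_exponent_le (by norm_num) ?_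
  push_cast
  nlinarith [(Nat.cast_nonneg k : (0 : ℝ) ≤ k)]

/-- A power bound for the rearrangement gives a power bound for integrals over sets. -/
theorem setLIntegral_le_of_rearr_le {α : Type*} [MeasurableSpace α] {μ : Measure α}
    {v : α → ℝ≥0∞} (hv : Measurable v) {K : ℝ≥0∞} {b σ : ℝ}
    (hσb : b ≤ 1 - σ) (hσ : 0 < σ) (hK : ∀ w, w ≠ 0 → w ≠ ∞ → rearr μ v w ≤ K * w ^ (-b))
    {E : Set α} (hE : μ E ≠ ∞) :
    ∫⁻ x in E, v x ∂μ ≤ (1 + 2 * ∑' k : ℕ, ((2 : ℝ≥0∞) ^ (-σ)) ^ k) * K * μ E ^ (1 - b) := by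
  rcases eq_or_ne (μ E) 0 with h0 | h0
  · rw [setLIntegral_measure_zero _ _ h0]
    exact bot_le
  refine (setLIntegral_le_rearr hv hE).trans ?_
  set w := μ E
  have hw : w * w ^ (-b) = w ^ (1 - b) := by
    rw [sub_eq_add_neg, ENNReal.rpow_add _ _ h0 hE, ENNReal.rpow_one]
  have h1 : w * rearr μ v w ≤ K * w ^ (1 - b) := by
    rw [← hw]
    calc w * rearr μ v w ≤ w * (K * w ^ (-b)) := by gcongr; exact hK w h0 hE
      _ = _ := by ring
  have h2 : ∀ k : ℕ, 2⁻¹ ^ k * w * rearr μ v (2⁻¹ ^ (k + 1) * w) ≤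
      2 * (K * w ^ (1 - b)) * ((2 : ℝ≥0∞) ^ (-σ)) ^ k := fun k => by
    have hne : (2⁻¹ : ℝ≥0∞) ^ (k + 1) ≠ 0 := pow_ne_zero _ (by simp)
    have hne' : (2⁻¹ : ℝ≥0∞) ^ (k + 1) ≠ ∞ := ENNReal.pow_ne_top (by simp)
    have hk := hK (2⁻¹ ^ (k + 1) * w) (mul_ne_zero hne h0) (ENNReal.mul_ne_top hne' hE)
    have h2pow := half_pow_mul_rpow_le hσ.le hσb k
    calc 2⁻¹ ^ k * w * rearr μ v (2⁻¹ ^ (k + 1) * w)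
        ≤ 2⁻¹ ^ k * w * (K * (2⁻¹ ^ (k + 1) * w) ^ (-b)) := by gcongr
      _ = (2⁻¹ ^ k * (2⁻¹ ^ (k + 1)) ^ (-b)) * (K * (w * w ^ (-b))) := by
          rw [ENNReal.mul_rpow_of_ne_top hne' hE]
          ring
      _ ≤ (2 * ((2 : ℝ≥0∞) ^ (-σ)) ^ k) * (K * w ^ (1 - b)) := by
          rw [hw]
          gcongr
      _ = _ := by ring
  calc _ ≤ K * w ^ (1 - b) + ∑' k : ℕ, 2 * (K * w ^ (1 - b)) * ((2 : ℝ≥0∞) ^ (-σ)) ^ k := by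
        exact add_le_add h1 (ENNReal.tsum_le_tsum h2)
    _ = _ := by
        rw [ENNReal.tsum_mul_left]
        ring

end Convolution

/-! ### Dilations in L^q((0,1), dt/t). -/

section LogNorm

variable {q : ℝ≥0∞} {φ ψ : ℝ → ℝ≥0∞}

/-- The quasinorm of `L^q((0,1), dt/t)`. -/
noncomputable def logNorm (q : ℝ≥0∞) (φ : ℝ → ℝ≥0∞) : ℝ≥0∞ :=
  if q = ∞ then ⨆ t ∈ Ioo (0 : ℝ) 1, φ t
  else (∫⁻ t in Ioo (0 : ℝ) 1, φ t ^ q.toReal * ENNReal.ofReal (1 / t)) ^ (1 / q.toReal)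

theorem logNorm_mono (h : ∀ t ∈ Ioo (0 : ℝ) 1, φ t ≤ ψ t) : logNorm q φ ≤ logNorm q ψ := by
  unfold logNorm
  split_ifs
  · exact iSup₂_mono h
  · refine ENNReal.rpow_le_rpow (setLIntegral_mono' measurableSet_Ioo fun t ht => ?_) (by positivity)
    gcongr
    exact h t ht

theorem logNorm_const_mul_le (hq : 0 < q) (hφ : Measurable φ) (c : ℝ≥0∞) :
    logNorm q (fun t => c * φ t) ≤ c * logNorm q φ := by
  unfold logNorm
  split_ifs with h
  · refine iSup₂_le fun t ht => ?_
    exact mul_le_mul_right (le_iSup₂ (f := fun t _ => φ t) t ht) c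
  · have hq' : 0 < q.toReal := ENNReal.toReal_pos hq.ne' h
    have hm : Measurable fun t => φ t ^ q.toReal * ENNReal.ofReal (1 / t) := by fun_prop
    simp_rw [ENNReal.mul_rpow_of_nonneg _ _ hq'.le, mul_assoc]
    rw [lintegral_const_mul _ hm, ENNReal.mul_rpow_of_nonneg _ _ (by positivity),
      ← ENNReal.rpow_mul, mul_one_div_cancel hq'.ne', ENNReal.rpow_one]

/-- The measure dt/t on (0,∞) is dilation invariant, and since ψ vanishes beyond 1, its integral
over (0,1) is the one over (0,∞). Hence c may be smaller or larger than 1. -/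
theorem lintegral_dilation_le (hψ : Measurable ψ) (h1 : ∀ t, 1 ≤ t → ψ t = 0) {c : ℝ}
    (hc : 0 < c) :
    ∫⁻ t in Ioo (0 : ℝ) 1, ψ (c * t) * ENNReal.ofReal (1 / t) ≤
      ∫⁻ t in Ioo (0 : ℝ) 1, ψ t * ENNReal.ofReal (1 / t) := by
  set H : ℝ → ℝ≥0∞ := (Ioi (0 : ℝ)).indicator fun t => ψ t * ENNReal.ofReal (1 / t) with hH
  have hHm : Measurable H := by
    refine Measurable.indicator ?_ measurableSet_Ioi
    fun_prop
  have hR : ∫⁻ t in Ioo (0 : ℝ) 1, ψ t * ENNReal.ofReal (1 / t) = ∫⁻ t, H t := by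
    rw [← lintegral_indicator measurableSet_Ioo]
    refine lintegral_congr fun t => ?_
    by_cases ht : 0 < t
    · by_cases ht1 : t < 1
      · simp [hH, ht, ht1]
      · simp [hH, ht, ht1, h1 t (not_lt.1 ht1)]
    · simp [hH, ht]
  have hmap : ∫⁻ t, H (c * t) = ENNReal.ofReal |c⁻¹| * ∫⁻ t, H t := by
    rw [← lintegral_map hHm (measurable_const_mul c), Real.map_volume_mul_left hc.ne',
      lintegral_smul_measure, smul_eq_mul]
  calc ∫⁻ t in Ioo (0 : ℝ) 1, ψ (c * t) * ENNReal.ofReal (1 / t)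
      ≤ ∫⁻ t in Ioo (0 : ℝ) 1, ENNReal.ofReal c * H (c * t) := by
        refine setLIntegral_mono' measurableSet_Ioo fun t ht => ?_
        have : 1 / t = c * (1 / (c * t)) := by
          have := ht.1.ne'
          field_simp
        have hmem : c * t ∈ Ioi (0 : ℝ) := mul_pos hc ht.1
        rw [hH, indicator_of_mem hmem, this, ENNReal.ofReal_mul hc.le]
        exact le_of_eq (by ring)
    _ ≤ ∫⁻ t, ENNReal.ofReal c * H (c * t) := setLIntegral_le_lintegral _ _
    _ = _ := by
        have hHc : Measurable fun t => H (c * t) := hHm.comp (measurable_const_mul c)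
        rw [lintegral_const_mul _ hHc, hmap, hR, ← mul_assoc,
          ← ENNReal.ofReal_mul hc.le, abs_of_pos (inv_pos.2 hc), mul_inv_cancel₀ hc.ne']
        simp

theorem tsum_geometric_ne_top {r : ℝ≥0∞} (hr : r < 1) : ∑' k : ℕ, r ^ k ≠ ∞ := by
  rw [ENNReal.tsum_geometric]
  exact ENNReal.inv_ne_top.2 (tsub_pos_of_lt hr).ne'

/-- A substitute for Hölder's inequality valid for every τ > 0: one factor r^k bounds each r^k x_k
by the ℓ^τ quantity m^(1/τ), and the other sums the geometric series. This is why the ratio is a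
square. -/
theorem tsum_geometric_mul_rpow_le {r : ℝ≥0∞} {τ : ℝ} (hτ : 0 < τ) (x : ℕ → ℝ≥0∞) :
    (∑' k, (r * r) ^ k * x k) ^ τ ≤ (∑' k : ℕ, r ^ k) ^ τ * ∑' k, (r ^ τ) ^ k * x k ^ τ := by
  set m := ∑' k, (r ^ τ) ^ k * x k ^ τ with hm
  have h1 : ∀ k, r ^ k * x k ≤ m ^ (1 / τ) := fun k => by
    rw [one_div, ENNReal.le_rpow_inv_iff hτ, ENNReal.mul_rpow_of_nonneg _ _ hτ.le]
    refine le_trans (le_of_eq ?_) (ENNReal.le_tsum k)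
    rw [← ENNReal.rpow_natCast, ← ENNReal.rpow_natCast, ← ENNReal.rpow_mul, ← ENNReal.rpow_mul,
      mul_comm τ]
  have h2 : ∑' k, (r * r) ^ k * x k ≤ (∑' k : ℕ, r ^ k) * m ^ (1 / τ) := by
    rw [← ENNReal.tsum_mul_right]
    refine ENNReal.tsum_le_tsum fun k => ?_
    rw [mul_pow, mul_assoc]
    gcongr
    exact h1 k
  refine (ENNReal.rpow_le_rpow h2 hτ.le).trans_eq ?_
  rw [ENNReal.mul_rpow_of_nonneg _ _ hτ.le, ← ENNReal.rpow_mul, one_div_mul_cancel hτ.ne',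
    ENNReal.rpow_one]

/-- Geometrically weighted sums of dyadic dilations are bounded in `L^q((0,1), dt/t)`. -/
theorem exists_logNorm_dyadic_le (hq : 0 < q) {r : ℝ≥0∞} (hr : r < 1) :
    ∃ C : ℝ≥0, ∀ φ : ℝ → ℝ≥0∞, Measurable φ → (∀ t, 1 ≤ t → φ t = 0) →
      logNorm q (fun t => ∑' k : ℕ, (r * r) ^ k * (φ (2⁻¹ ^ (k + 1) * t) + φ (2 ^ k * t))) ≤
        C * logNorm q φ := by
  rcases eq_or_ne q ∞ with rfl | hq'
  · have hrr : r * r < 1 := mul_lt_one_of_nonneg_of_lt_one_left bot_le hr hr.le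
    refine ⟨(∑' k : ℕ, (r * r) ^ k * 2).toNNReal, fun φ _ h1 => ?_⟩
    rw [ENNReal.coe_toNNReal (by
      rw [ENNReal.tsum_mul_right]
      exact ENNReal.mul_ne_top (tsum_geometric_ne_top hrr) (by simp))]
    simp only [logNorm, if_true]
    have hle : ∀ t, 0 < t → φ t ≤ ⨆ t ∈ Ioo (0 : ℝ) 1, φ t := fun t ht => by
      rcases lt_or_ge t 1 with h | h
      · exact le_iSup₂ (f := fun t _ => φ t) t ⟨ht, h⟩
      · simp [h1 t h]
    refine iSup₂_le fun t ht => ?_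
    rw [← ENNReal.tsum_mul_right]
    refine ENNReal.tsum_le_tsum fun k => ?_
    rw [mul_assoc, two_mul]
    have := ht.1
    gcongr <;> exact hle _ (by positivity)
  · have hτ : 0 < q.toReal := ENNReal.toReal_pos hq.ne' hq'
    set τ := q.toReal
    set S := ∑' k : ℕ, r ^ k
    set S' := ∑' k : ℕ, (r ^ τ) ^ k
    have hS : S ≠ ∞ := tsum_geometric_ne_top hr
    have hS' : S' ≠ ∞ := tsum_geometric_ne_top (ENNReal.rpow_lt_one hr hτ)
    have hfin : (S ^ τ * (S' * (2 ^ τ * 2))) ^ (1 / τ) ≠ ∞ := by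
      refine ENNReal.rpow_ne_top_of_nonneg (by positivity) ?_
      refine ENNReal.mul_ne_top (ENNReal.rpow_ne_top_of_nonneg hτ.le hS)
        (ENNReal.mul_ne_top hS' (ENNReal.mul_ne_top ?_ (by simp)))
      exact ENNReal.rpow_ne_top_of_nonneg hτ.le (by simp)
    refine ⟨((S ^ τ * (S' * (2 ^ τ * 2))) ^ (1 / τ)).toNNReal, fun φ hφ h1 => ?_⟩
    rw [ENNReal.coe_toNNReal hfin]
    simp only [logNorm, if_neg hq']
    rw [← ENNReal.mul_rpow_of_nonneg _ _ (by positivity)]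
    refine ENNReal.rpow_le_rpow ?_ (by positivity)
    set ψ : ℝ → ℝ≥0∞ := fun t => φ t ^ τ with hψdef
    have hψ : Measurable ψ := hφ.pow_const τ
    have hψ1 : ∀ t, 1 ≤ t → ψ t = 0 := fun t ht => by simp [hψdef, h1 t ht, hτ]
    set I := ∫⁻ t in Ioo (0 : ℝ) 1, ψ t * ENNReal.ofReal (1 / t) with hI
    have hdil : ∀ c : ℝ, Measurable fun t => ψ (c * t) * ENNReal.ofReal (1 / t) := fun c =>
      (hψ.comp (measurable_const_mul c)).mul (by fun_prop)
    -- The bound x + y ≤ 2 max(x, y) avoids distinguishing τ < 1 from τ ≥ 1.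
    have hadd : ∀ x y : ℝ≥0∞, (x + y) ^ τ ≤ 2 ^ τ * (x ^ τ + y ^ τ) := fun x y => by
      rcases le_total x y with h | h
      · calc (x + y) ^ τ ≤ (2 * y) ^ τ := by rw [two_mul]; gcongr
          _ = 2 ^ τ * y ^ τ := ENNReal.mul_rpow_of_nonneg _ _ hτ.le
          _ ≤ _ := by gcongr; exact le_add_self
      · calc (x + y) ^ τ ≤ (2 * x) ^ τ := by rw [two_mul]; gcongr
          _ = 2 ^ τ * x ^ τ := ENNReal.mul_rpow_of_nonneg _ _ hτ.le
          _ ≤ _ := by gcongr; exact le_self_add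
    calc _ ≤ ∫⁻ t in Ioo (0 : ℝ) 1, S ^ τ * ∑' k : ℕ, (r ^ τ) ^ k * (2 ^ τ *
            (ψ (2⁻¹ ^ (k + 1) * t) * ENNReal.ofReal (1 / t) +
              ψ (2 ^ k * t) * ENNReal.ofReal (1 / t))) := by
          refine lintegral_mono fun t => ?_
          refine (mul_le_mul_left (tsum_geometric_mul_rpow_le hτ _) _).trans ?_
          rw [mul_assoc, ← ENNReal.tsum_mul_right]
          refine mul_le_mul_right (ENNReal.tsum_le_tsum fun k => ?_) _
          rw [mul_assoc, ← add_mul, ← mul_assoc (2 ^ τ)]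
          exact mul_le_mul_right (mul_le_mul_left (hadd _ _) _) _
      _ = S ^ τ * ∑' k : ℕ, (r ^ τ) ^ k * (2 ^ τ *
            ((∫⁻ t in Ioo (0 : ℝ) 1, ψ (2⁻¹ ^ (k + 1) * t) * ENNReal.ofReal (1 / t)) +
              ∫⁻ t in Ioo (0 : ℝ) 1, ψ (2 ^ k * t) * ENNReal.ofReal (1 / t))) := by
          have hm : ∀ k : ℕ, Measurable fun t => (r ^ τ) ^ k * (2 ^ τ *
            (ψ (2⁻¹ ^ (k + 1) * t) * ENNReal.ofReal (1 / t) +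
              ψ (2 ^ k * t) * ENNReal.ofReal (1 / t))) := fun k =>
            (((hdil _).add (hdil _)).const_mul _).const_mul _
          rw [lintegral_const_mul _ (Measurable.tsum hm),
            lintegral_tsum fun k => (hm k).aemeasurable]
          congr 1
          refine tsum_congr fun k => ?_
          have hm₁ : Measurable fun t => ψ (2⁻¹ ^ (k + 1) * t) * ENNReal.ofReal (1 / t) +
              ψ (2 ^ k * t) * ENNReal.ofReal (1 / t) := (hdil _).add (hdil _)
          rw [lintegral_const_mul _ (hm₁.const_mul _), lintegral_const_mul _ hm₁,
            lintegral_add_left (hdil _)]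
      _ ≤ S ^ τ * ∑' k : ℕ, (r ^ τ) ^ k * (2 ^ τ * (I + I)) := by
          gcongr
          · exact lintegral_dilation_le hψ hψ1 (by positivity)
          · exact lintegral_dilation_le hψ hψ1 (by positivity)
      _ = _ := by
          rw [ENNReal.tsum_mul_right]
          ring

end LogNorm

/-! ### O'Neil's inequality on the unit interval. -/

section NormalizedRearrangement

/-- The rearrangement of `u` on `Ω`, rescaled to the unit interval. -/
noncomputable def normRearr {α : Type*} [MeasurableSpace α] (μ : Measure α) (Ω : Set α)
    (u : α → ℝ≥0∞) (t : ℝ) : ℝ≥0∞ :=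
  rearr (μ.restrict Ω) u (ENNReal.ofReal t * μ Ω)

variable {α : Type*} [MeasurableSpace α] {μ : Measure α} {Ω : Set α} {u v : α → ℝ≥0∞}

theorem normRearr_antitone : Antitone (normRearr μ Ω u) := fun s t hst =>
  rearr_antitone (by gcongr)

theorem normRearr_eq_zero {t : ℝ} (ht : 1 ≤ t) : normRearr μ Ω u t = 0 := by
  refine rearr_eq_zero ((measure_mono (subset_univ _)).trans ?_)
  rw [Measure.restrict_apply_univ]
  exact le_mul_of_one_le_left bot_le (by simpa using ht)

theorem normRearr_indicator (hΩ : MeasurableSet Ω) (t : ℝ) :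
    rearr μ (Ω.indicator u) (ENNReal.ofReal t * μ Ω) = normRearr μ Ω u t :=
  (rearr_restrict hΩ).symm

theorem normRearr_of_measure_eq_zero (h : μ Ω = 0) (t : ℝ) : normRearr μ Ω u t = 0 := by
  refine rearr_eq_zero ?_
  simp [Measure.restrict_eq_zero.2 h]

theorem rearr_indicator_le_of_normRearr_le (hΩ : MeasurableSet Ω) (hM : μ Ω ≠ 0) (hM' : μ Ω ≠ ∞)
    {K : ℝ≥0∞} {b : ℝ}
    (hK : ∀ t ∈ Ioo (0 : ℝ) 1, ENNReal.ofReal (t ^ b) * normRearr μ Ω u t ≤ K)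
    {w : ℝ≥0∞} (hw : w ≠ 0) (hw' : w ≠ ∞) :
    rearr μ (Ω.indicator u) w ≤ K * μ Ω ^ b * w ^ (-b) := by
  rw [← rearr_restrict hΩ]
  rcases le_or_gt (μ Ω) w with h | h
  · rw [rearr_eq_zero]
    · exact bot_le
    · refine (measure_mono (subset_univ _)).trans ?_
      rwa [Measure.restrict_apply_univ]
  have hT : w / μ Ω ≠ ∞ := ENNReal.div_ne_top hw' hM
  have hT0 : w / μ Ω ≠ 0 := ENNReal.div_ne_zero.2 ⟨hw, hM'⟩
  have hT1 : w / μ Ω < 1 := ENNReal.div_lt_of_lt_mul (by simpa using h)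
  have ht0 : 0 < (w / μ Ω).toReal := ENNReal.toReal_pos hT0 hT
  have ht1 : (w / μ Ω).toReal < 1 := by
    rw [← ENNReal.toReal_one]
    exact (ENNReal.toReal_lt_toReal hT (by simp)).2 hT1
  have h := hK _ ⟨ht0, ht1⟩
  rw [normRearr, ← ENNReal.ofReal_rpow_of_pos ht0, ENNReal.ofReal_toReal hT,
    ENNReal.div_mul_cancel hM hM'] at h
  have hp0 : (w / μ Ω) ^ b ≠ 0 := (ENNReal.rpow_pos (pos_iff_ne_zero.2 hT0) hT).ne'
  have hp1 : (w / μ Ω) ^ b ≠ ∞ := ENNReal.rpow_ne_top_of_ne_zero hT0 hT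
  rw [mul_comm, ← ENNReal.le_div_iff_mul_le (Or.inl hp0) (Or.inl hp1)] at h
  refine h.trans_eq ?_
  rw [div_eq_mul_inv, ← ENNReal.rpow_neg, div_eq_mul_inv,
    ENNReal.mul_rpow_of_ne_top hw' (ENNReal.inv_ne_top.2 hM), ENNReal.inv_rpow,
    ← ENNReal.rpow_neg, neg_neg]
  ring

/-- O'Neil's inequality for the rescaled rearrangements. -/
theorem normRearr_lconv_le {G : Type*} [AddCommGroup G] [MeasurableSpace G] [MeasurableAdd₂ G]
    [MeasurableNeg G] {μ : Measure G} [SFinite μ] [μ.IsAddLeftInvariant] [μ.IsNegInvariant]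
    {Ω : Set G} (hΩ : MeasurableSet Ω) (hΩ' : μ Ω ≠ ∞) {u v : G → ℝ≥0∞}
    (hu : Measurable u) (hv : Measurable v) {a b σ : ℝ} {K : ℝ≥0∞}
    (hσ : 0 < σ) (ha : a ≤ 1 - σ) (hb : b ≤ 1 - σ) (hab : σ ≤ a + b - 1)
    (hK : ∀ t ∈ Ioo (0 : ℝ) 1, ENNReal.ofReal (t ^ b) * normRearr μ Ω v t ≤ K)
    {t : ℝ} (ht : t ∈ Ioo (0 : ℝ) 1) :
    ENNReal.ofReal (t ^ (a + b - 1)) *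
        normRearr μ Ω (lconv μ (Ω.indicator u) (Ω.indicator v)) t ≤
      (2 * (1 + 2 * ∑' k : ℕ, ((2 : ℝ≥0∞) ^ (-σ)) ^ k) * μ Ω * K) *
        ∑' k : ℕ, ((2 : ℝ≥0∞) ^ (-σ)) ^ k *
          (ENNReal.ofReal ((2⁻¹ ^ (k + 1) * t) ^ a) * normRearr μ Ω u (2⁻¹ ^ (k + 1) * t) +
            ENNReal.ofReal ((2 ^ k * t) ^ a) * normRearr μ Ω u (2 ^ k * t)) := by
  rcases eq_or_ne (μ Ω) 0 with hM | hM
  · simp [normRearr_of_measure_eq_zero hM]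
  set M := μ Ω with hMdef
  set ρ := (2 : ℝ≥0∞) ^ (-σ) with hρ
  set A := 1 + 2 * ∑' k : ℕ, ρ ^ k with hA
  set D := A * (K * M ^ b) with hD
  have hb0 : 0 < b := by linarith
  -- The weak bound on v, with b < 1, yields the growth condition with exponent β = 1 - b.
  have hDE : ∀ E, MeasurableSet E → μ E ≠ ∞ →
      ∫⁻ x in E, Ω.indicator v x ∂μ ≤ D * μ E ^ (1 - b) := fun E _ hE =>
    setLIntegral_le_of_rearr_le (hv.indicator hΩ) hb hσ
      (fun w hw hw' => rearr_indicator_le_of_normRearr_le hΩ hM hΩ' hK hw hw') hE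
  set T := ENNReal.ofReal t with hT
  have hT0 : T ≠ 0 := by simpa [hT] using ht.1
  have hT' : T ≠ ∞ := ENNReal.ofReal_ne_top
  have hsupp : μ {x | 0 < Ω.indicator u x} ≠ ∞ := by
    refine measure_ne_top_of_subset (fun x hx => ?_) hΩ'
    by_contra h
    have hx' : 0 < Ω.indicator u x := hx
    simp [h] at hx'
  have hs0 : T * M ≠ 0 := mul_ne_zero hT0 hM
  have hs' : T * M ≠ ∞ := ENNReal.mul_ne_top hT' hΩ'
  have key := rearr_lconv_le (s := T * M) (hu.indicator hΩ) (hv.indicator hΩ)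
    (by linarith : 0 ≤ 1 - b) (by linarith) hDE hsupp hΩ hΩ' hs0 hs'
  have hscale : ∀ c : ℝ, 0 ≤ c →
      rearr μ (Ω.indicator u) (ENNReal.ofReal c * (T * M)) = normRearr μ Ω u (c * t) := by
    intro c hc
    rw [← mul_assoc, hT, ← ENNReal.ofReal_mul hc, normRearr_indicator hΩ]
  have hs1 : ∀ k : ℕ, rearr μ (Ω.indicator u) (2⁻¹ ^ k * (T * M)) =
      normRearr μ Ω u (2⁻¹ ^ k * t) := fun k => by
    rw [← hscale _ (by positivity), ENNReal.ofReal_pow (by positivity),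
      ENNReal.ofReal_inv_of_pos (by positivity), ENNReal.ofReal_ofNat]
  have hs2 : ∀ k : ℕ, rearr μ (Ω.indicator u) (2 ^ k * (T * M)) =
      normRearr μ Ω u (2 ^ k * t) := fun k => by
    rw [← hscale _ (by positivity), ENNReal.ofReal_pow (by positivity), ENNReal.ofReal_ofNat]
  have hp1 : ∀ k : ℕ, ENNReal.ofReal ((2⁻¹ ^ (k + 1) * t) ^ a) =
      (2⁻¹ ^ (k + 1)) ^ a * T ^ a := fun k => by
    have := ht.1
    rw [← ENNReal.ofReal_rpow_of_pos (by positivity), ENNReal.ofReal_mul (by positivity),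
      ENNReal.ofReal_pow (by positivity), ENNReal.ofReal_inv_of_pos (by positivity),
      ENNReal.ofReal_ofNat, ENNReal.mul_rpow_of_ne_top (ENNReal.pow_ne_top (by simp)) hT']
  have hp2 : ∀ k : ℕ, ENNReal.ofReal ((2 ^ k * t) ^ a) = (2 ^ k) ^ a * T ^ a := fun k => by
    have := ht.1
    rw [← ENNReal.ofReal_rpow_of_pos (by positivity), ENNReal.ofReal_mul (by positivity),
      ENNReal.ofReal_pow (by positivity), ENNReal.ofReal_ofNat,
      ENNReal.mul_rpow_of_ne_top (ENNReal.pow_ne_top (by simp)) hT']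
  simp only [hs1, hs2] at key
  simp only [hp1, hp2, mul_add, ENNReal.tsum_add]
  have hTa : T ^ (a + b - 1) * T ^ (1 - b) = T ^ a := by
    rw [← ENNReal.rpow_add _ _ hT0 hT']
    ring_nf
  have hMM : M ^ b * M ^ (1 - b) = M := by
    rw [← ENNReal.rpow_add _ _ hM hΩ']
    simp
  have hs1b : (T * M) ^ (1 - b - 1) * (T * M) = T ^ (1 - b) * M ^ (1 - b) := by
    nth_rewrite 2 [← ENNReal.rpow_one (T * M)]
    rw [← ENNReal.rpow_add _ _ hs0 hs', sub_add_cancel, ENNReal.mul_rpow_of_ne_top hT' hΩ']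
  rw [← ENNReal.ofReal_rpow_of_pos ht.1]
  refine (mul_le_mul_right key _).trans ?_
  rw [mul_add, ← ENNReal.tsum_mul_left, ← ENNReal.tsum_mul_left, ← ENNReal.tsum_mul_left,
    ← ENNReal.tsum_mul_left, ← ENNReal.tsum_mul_left]
  refine add_le_add (ENNReal.tsum_le_tsum fun k => ?_) (ENNReal.tsum_le_tsum fun k => ?_)
  · have hne : (2⁻¹ : ℝ≥0∞) ^ (k + 1) ≠ 0 := pow_ne_zero _ (by simp)
    have hne' : (2⁻¹ : ℝ≥0∞) ^ (k + 1) ≠ ∞ := ENNReal.pow_ne_top (by simp)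
    have h1 : (2⁻¹ : ℝ≥0∞) ^ k ≤ 2 * ρ ^ k * (2⁻¹ ^ (k + 1)) ^ a := by
      calc (2⁻¹ : ℝ≥0∞) ^ k = 2⁻¹ ^ k * (2⁻¹ ^ (k + 1)) ^ (-a) * (2⁻¹ ^ (k + 1)) ^ a := by
            rw [mul_assoc, ← ENNReal.rpow_add _ _ hne hne']
            simp
        _ ≤ _ := by
            exact mul_le_mul_left (half_pow_mul_rpow_le hσ.le ha k) _
    calc T ^ (a + b - 1) * (D * (T * M) ^ (1 - b - 1) *
          (2⁻¹ ^ k * (T * M) * normRearr μ Ω u (2⁻¹ ^ (k + 1) * t)))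
        = A * K * 2⁻¹ ^ k * normRearr μ Ω u (2⁻¹ ^ (k + 1) * t) * (T ^ (a + b - 1) * M ^ b *
            ((T * M) ^ (1 - b - 1) * (T * M))) := by
          rw [hD]
          ring
      _ = A * K * 2⁻¹ ^ k * normRearr μ Ω u (2⁻¹ ^ (k + 1) * t) *
            ((T ^ (a + b - 1) * T ^ (1 - b)) * (M ^ b * M ^ (1 - b))) := by
          rw [hs1b]
          ring
      _ ≤ A * K * (2 * ρ ^ k * (2⁻¹ ^ (k + 1)) ^ a) * normRearr μ Ω u (2⁻¹ ^ (k + 1) * t) *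
            (T ^ a * M) := by
          rw [hTa, hMM]
          gcongr
      _ = _ := by ring
  · have hne' : (2 : ℝ≥0∞) ^ (k + 1) ≠ ∞ := ENNReal.pow_ne_top (by simp)
    calc T ^ (a + b - 1) * (normRearr μ Ω u (2 ^ k * t) * (D * (2 ^ (k + 1) * (T * M)) ^ (1 - b)))
        = A * K * (2 ^ (k + 1)) ^ (1 - b) * normRearr μ Ω u (2 ^ k * t) *
            ((T ^ (a + b - 1) * T ^ (1 - b)) * (M ^ b * M ^ (1 - b))) := by
          rw [ENNReal.mul_rpow_of_ne_top hne' hs', ENNReal.mul_rpow_of_ne_top hT' hΩ', hD]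
          ring
      _ ≤ A * K * (2 * ρ ^ k * (2 ^ k) ^ a) * normRearr μ Ω u (2 ^ k * t) * (T ^ a * M) := by
          rw [hTa, hMM]
          gcongr
          exact two_pow_rpow_le hb0.le hab k
      _ = _ := by ring

end NormalizedRearrangement

/-! ### Lorentz functionals and the uniform O'Neil inequality. -/

section LorentzQuasinorm

variable {α : Type*} [MeasurableSpace α] {μ : Measure α} {Ω : Set α} {u v : α → ℝ≥0∞}
  {a b : ℝ} {q : ℝ≥0∞}

/-- The normalized Lorentz functional of a function with values in `[0, ∞]`. -/
noncomputable def lorentzQuasinorm (μ : Measure α) (Ω : Set α) (q : ℝ≥0∞) (u : α → ℝ≥0∞)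
    (a : ℝ) : ℝ≥0∞ :=
  logNorm q fun t => ENNReal.ofReal (t ^ a) * normRearr μ Ω u t

theorem measurable_rpow_mul_normRearr :
    Measurable fun t => ENNReal.ofReal (t ^ a) * normRearr μ Ω u t := by
  have : Measurable (normRearr μ Ω u) := normRearr_antitone.measurable
  fun_prop

theorem lorentzQuasinorm_antitone : Antitone (lorentzQuasinorm μ Ω q u) := fun a b hab => by
  refine logNorm_mono fun t ht => ?_
  gcongr ENNReal.ofReal ?_ * _
  exact Real.rpow_le_rpow_of_exponent_ge ht.1 ht.2.le hab

theorem lorentzQuasinorm_mono (h : ∀ x, u x ≤ v x) :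
    lorentzQuasinorm μ Ω q u a ≤ lorentzQuasinorm μ Ω q v a :=
  logNorm_mono fun _ _ => mul_le_mul_right (rearr_mono h) _

theorem lorentzQuasinorm_congr_ae (h : u =ᵐ[μ.restrict Ω] v) :
    lorentzQuasinorm μ Ω q u = lorentzQuasinorm μ Ω q v := by
  funext a
  simp only [lorentzQuasinorm, normRearr, rearr_congr_ae h]

theorem ae_lt_top_of_logNorm_lt_top {φ : ℝ → ℝ≥0∞} (hq : 0 < q) (hφ : Measurable φ)
    (h : logNorm q φ < ∞) : ∀ᵐ t ∂volume.restrict (Ioo (0 : ℝ) 1), φ t < ∞ := by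
  unfold logNorm at h
  split_ifs at h with hq'
  · filter_upwards [ae_restrict_mem measurableSet_Ioo] with t ht
    exact (le_iSup₂ (f := fun t _ => φ t) t ht).trans_lt h
  · have hτ : 0 < q.toReal := ENNReal.toReal_pos hq.ne' hq'
    have hm : Measurable fun t => φ t ^ q.toReal * ENNReal.ofReal (1 / t) := by fun_prop
    have hfin := (ENNReal.rpow_lt_top_iff_of_pos (by positivity)).1 h
    filter_upwards [ae_lt_top hm hfin.ne, ae_restrict_mem measurableSet_Ioo] with t h1 ht
    by_contra! htop
    rw [top_le_iff.1 htop, ENNReal.top_rpow_of_pos hτ, ENNReal.top_mul] at h1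
    · exact lt_irrefl _ h1
    · simp [ht.1]

/-- A finite functional makes u^*(t|Ω|) finite for arbitrarily small t, and the set where u = ∞ then
has measure at most t|Ω|. Applied to |f| * |g|, this gives absolute convergence of the convolution.
-/
theorem ae_lt_top_of_lorentzQuasinorm_lt_top (hq : 0 < q) (hΩ : μ Ω ≠ ∞)
    (h : lorentzQuasinorm μ Ω q u a < ∞) : ∀ᵐ x ∂μ.restrict Ω, u x < ∞ := by
  have hae := ae_lt_top_of_logNorm_lt_top hq measurable_rpow_mul_normRearr h
  have hbound : ∀ k : ℕ, μ.restrict Ω {x | ¬ u x < ∞} ≤ 2⁻¹ ^ k * μ Ω := fun k => by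
    have hpos : (0 : ℝ) < 2⁻¹ ^ k := by positivity
    have hsub : Ioo (0 : ℝ) (2⁻¹ ^ k) ⊆ Ioo 0 1 :=
      Ioo_subset_Ioo_right (pow_le_one₀ (by positivity) (by norm_num))
    have hne : (ae (volume.restrict (Ioo (0 : ℝ) (2⁻¹ ^ k)))).NeBot := by
      rw [ae_neBot, Ne, Measure.restrict_eq_zero, Real.volume_Ioo]
      simp
    obtain ⟨t, ht, htm⟩ := ((ae_restrict_of_ae_restrict_of_subset hsub hae).and
      (ae_restrict_mem measurableSet_Ioo)).exists
    have hfin : normRearr μ Ω u t < ∞ := by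
      by_contra! htop
      rw [top_le_iff.1 htop, ENNReal.mul_top] at ht
      · exact lt_irrefl _ ht
      · have := Real.rpow_pos_of_pos htm.1 a
        simpa using this
    calc μ.restrict Ω {x | ¬ u x < ∞} ≤ μ.restrict Ω {x | normRearr μ Ω u t < u x} :=
          measure_mono fun x hx => hfin.trans_le (not_lt.1 hx)
      _ ≤ ENNReal.ofReal t * μ Ω := measure_rearr_lt_le
      _ ≤ 2⁻¹ ^ k * μ Ω := by
          gcongr
          calc ENNReal.ofReal t ≤ ENNReal.ofReal (2⁻¹ ^ k) := ENNReal.ofReal_le_ofReal htm.2.le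
            _ = 2⁻¹ ^ k := by
              rw [ENNReal.ofReal_pow (by positivity), ENNReal.ofReal_inv_of_pos (by positivity),
                ENNReal.ofReal_ofNat]
  have hlim : Filter.Tendsto (fun k : ℕ => (2⁻¹ : ℝ≥0∞) ^ k * μ Ω) Filter.atTop (nhds 0) := by
    have := ENNReal.Tendsto.mul_const
      (ENNReal.tendsto_pow_atTop_nhds_zero_of_lt_one (r := 2⁻¹) (by simp)) (Or.inr hΩ)
    simpa using this
  exact le_antisymm (ge_of_tendsto' hlim hbound) bot_le

/-- O'Neil's inequality for Lorentz quasinorms, uniformly in the exponents. -/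
theorem exists_lorentzQuasinorm_lconv_le {G : Type*} [AddCommGroup G] [MeasurableSpace G]
    [MeasurableAdd₂ G] [MeasurableNeg G] {μ : Measure G} [SFinite μ] [μ.IsAddLeftInvariant]
    [μ.IsNegInvariant] {Ω : Set G} (hΩ : MeasurableSet Ω) (hΩ' : μ Ω ≠ ∞) (hq : 0 < q) {σ : ℝ}
    (hσ : 0 < σ) :
    ∃ K : ℝ≥0, ∀ u v : G → ℝ≥0∞, Measurable u → Measurable v → ∀ a b : ℝ, a ≤ 1 - σ →
      b ≤ 1 - σ → σ ≤ a + b - 1 →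
      lorentzQuasinorm μ Ω q (lconv μ (Ω.indicator u) (Ω.indicator v)) (a + b - 1) ≤
        K * lorentzQuasinorm μ Ω q u a * lorentzQuasinorm μ Ω ∞ v b := by
  have hr : ∀ x : ℝ, 0 < x → (2 : ℝ≥0∞) ^ (-x) < 1 := fun x hx =>
    ENNReal.rpow_lt_one_of_one_lt_of_neg (by norm_num) (by linarith)
  -- The exponent σ/2 is chosen so that the squared ratio is the available decay 2^{-σ}.
  obtain ⟨C, hC⟩ := exists_logNorm_dyadic_le hq (hr (σ / 2) (by linarith))
  have hrr : (2 : ℝ≥0∞) ^ (-(σ / 2)) * 2 ^ (-(σ / 2)) = 2 ^ (-σ) := by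
    rw [← ENNReal.rpow_add _ _ (by simp) (by simp)]
    ring_nf
  rw [hrr] at hC
  set B := 2 * (1 + 2 * ∑' k : ℕ, ((2 : ℝ≥0∞) ^ (-σ)) ^ k) * μ Ω with hB
  have hBtop : B ≠ ∞ := by
    refine ENNReal.mul_ne_top (ENNReal.mul_ne_top (by simp) (ENNReal.add_ne_top.2 ⟨by simp,
      ENNReal.mul_ne_top (by simp) (tsum_geometric_ne_top (hr σ hσ))⟩)) hΩ'
  refine ⟨B.toNNReal * C, fun u v hu hv a b ha hb hab => ?_⟩
  rw [ENNReal.coe_mul, ENNReal.coe_toNNReal hBtop]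
  set φ : ℝ → ℝ≥0∞ := fun t => ENNReal.ofReal (t ^ a) * normRearr μ Ω u t with hφ
  have hφm : Measurable φ := measurable_rpow_mul_normRearr
  have hφ1 : ∀ t, 1 ≤ t → φ t = 0 := fun t ht => by simp [hφ, normRearr_eq_zero ht]
  have hsm : Measurable fun t => ∑' k : ℕ, ((2 : ℝ≥0∞) ^ (-σ)) ^ k *
      (φ (2⁻¹ ^ (k + 1) * t) + φ (2 ^ k * t)) :=
    Measurable.tsum fun k => ((hφm.comp (measurable_const_mul _)).add
      (hφm.comp (measurable_const_mul _))).const_mul _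
  calc lorentzQuasinorm μ Ω q (lconv μ (Ω.indicator u) (Ω.indicator v)) (a + b - 1)
      ≤ logNorm q fun t => (B * lorentzQuasinorm μ Ω ∞ v b) *
          ∑' k : ℕ, ((2 : ℝ≥0∞) ^ (-σ)) ^ k * (φ (2⁻¹ ^ (k + 1) * t) + φ (2 ^ k * t)) := by
        refine logNorm_mono fun t ht => ?_
        refine normRearr_lconv_le hΩ hΩ' hu hv hσ ha hb hab (fun s hs => ?_) ht
        simp only [lorentzQuasinorm, logNorm, if_true]
        exact le_iSup₂ (f := fun t _ => ENNReal.ofReal (t ^ b) * normRearr μ Ω v t) s hs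
    _ ≤ (B * lorentzQuasinorm μ Ω ∞ v b) * (C * logNorm q φ) :=
        (logNorm_const_mul_le hq hsm _).trans (mul_le_mul_right (hC φ hφm hφ1) _)
    _ = B * C * lorentzQuasinorm μ Ω q u a * lorentzQuasinorm μ Ω ∞ v b := by
        change _ = B * C * logNorm q φ * _
        ring

end LorentzQuasinorm

/-! ### Grand quasinorms of abstract antitone scales. -/

section GrandQuasinorm

/-- The grand quasinorm built from a scale of quasinorms `N`. -/
noncomputable def grandQuasinorm (θ A : ℝ) (N : ℝ → ℝ≥0∞) : ℝ≥0∞ :=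
  if 0 ≤ θ then ⨆ ε ∈ Ioo (0 : ℝ) 1, ENNReal.ofReal (ε ^ θ) * N (A + ε)
  else ⨅ ε ∈ Ioo (0 : ℝ) A, ENNReal.ofReal (ε ^ θ) * N (A - ε)

variable {θ A B D σ ε δ η : ℝ} {N N₁ N₂ : ℝ → ℝ≥0∞} {X Z : ℝ≥0∞}

theorem grandQuasinorm_mono (h : ∀ a, N₁ a ≤ N₂ a) :
    grandQuasinorm θ A N₁ ≤ grandQuasinorm θ A N₂ := by
  unfold grandQuasinorm
  split_ifs
  · exact iSup₂_mono fun ε _ => mul_le_mul_right (h _) _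
  · exact iInf₂_mono fun ε _ => mul_le_mul_right (h _) _

theorem exists_lt_top_of_grandQuasinorm_lt_top (h : grandQuasinorm θ A N < ∞) :
    ∃ a, N a < ∞ := by
  have aux : ∀ ε : ℝ, 0 < ε → ∀ a, ENNReal.ofReal (ε ^ θ) * N a < ∞ → N a < ∞ := by
    intro ε hε a hlt
    by_contra! htop
    rw [top_le_iff.1 htop, ENNReal.mul_top] at hlt
    · exact lt_irrefl _ hlt
    · have := Real.rpow_pos_of_pos hε θ
      simpa using this
  unfold grandQuasinorm at h
  split_ifs at h
  · refine ⟨A + 1 / 2, aux (1 / 2) (by norm_num) _ (lt_of_le_of_lt ?_ h)⟩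
    exact le_iSup₂ (f := fun ε _ => ENNReal.ofReal (ε ^ θ) * N (A + ε)) (1 / 2 : ℝ)
      (by constructor <;> norm_num)
  · obtain ⟨ε, hε⟩ := iInf_lt_iff.1 h
    obtain ⟨hε', hlt⟩ := iInf_lt_iff.1 hε
    exact ⟨_, aux ε hε'.1 _ hlt⟩

theorem le_rpow_neg_mul_of_rpow_mul_le (hε : 0 < ε) {x : ℝ≥0∞}
    (h : ENNReal.ofReal (ε ^ θ) * x ≤ X) : x ≤ ENNReal.ofReal (ε ^ (-θ)) * X := by
  calc x = ENNReal.ofReal (ε ^ (-θ)) * (ENNReal.ofReal (ε ^ θ) * x) := by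
        rw [← mul_assoc, ← ENNReal.ofReal_mul (by positivity), ← Real.rpow_add hε]
        simp
    _ ≤ _ := by gcongr

theorem rpow_mul_le_of_le_rpow_neg_mul (hε : 0 < ε) {x : ℝ≥0∞}
    (h : x ≤ ENNReal.ofReal (ε ^ (-θ)) * X) : ENNReal.ofReal (ε ^ θ) * x ≤ X := by
  calc ENNReal.ofReal (ε ^ θ) * x ≤ ENNReal.ofReal (ε ^ θ) * (ENNReal.ofReal (ε ^ (-θ)) * X) := by
        gcongr
    _ = X := by
        rw [← mul_assoc, ← ENNReal.ofReal_mul (by positivity), ← Real.rpow_add hε]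
        simp

theorem le_of_grandQuasinorm_of_nonneg (hθ : 0 ≤ θ) (hε : ε ∈ Ioo (0 : ℝ) 1) :
    N (A + ε) ≤ ENNReal.ofReal (ε ^ (-θ)) * grandQuasinorm θ A N := by
  refine le_rpow_neg_mul_of_rpow_mul_le hε.1 ?_
  rw [grandQuasinorm, if_pos hθ]
  exact le_iSup₂ (f := fun ε _ => ENNReal.ofReal (ε ^ θ) * N (A + ε)) ε hε

/-- Shifts above σ are compared with σ itself by monotonicity, at the price of the factor σ^(-θ). -/
theorem grandQuasinorm_le_of_nonneg (hN : Antitone N) (hθ : 0 ≤ θ) (hσ : 0 < σ) (hσ1 : σ ≤ 1)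
    (h : ∀ ε ∈ Ioc (0 : ℝ) σ, N (D + ε) ≤ ENNReal.ofReal (ε ^ (-θ)) * Z) :
    grandQuasinorm θ D N ≤ ENNReal.ofReal (σ ^ (-θ)) * Z := by
  rw [grandQuasinorm, if_pos hθ]
  refine iSup₂_le fun ε hε => ?_
  rcases le_total ε σ with hle | hle
  · refine (rpow_mul_le_of_le_rpow_neg_mul hε.1 (h ε ⟨hε.1, hle⟩)).trans ?_
    refine le_mul_of_one_le_left bot_le ?_
    rw [ENNReal.one_le_ofReal]
    exact Real.one_le_rpow_of_pos_of_le_one_of_nonpos hσ hσ1 (by linarith)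
  · calc ENNReal.ofReal (ε ^ θ) * N (D + ε) ≤ 1 * N (D + σ) := by
          gcongr
          · rw [ENNReal.ofReal_le_one]
            exact Real.rpow_le_one hε.1.le hε.2.le hθ
          · exact hN (by linarith)
      _ ≤ _ := by
          rw [one_mul]
          exact h σ ⟨hσ, le_rfl⟩

theorem grandQuasinorm_le_of_neg (hθ : θ < 0) (hε : ε ∈ Ioo 0 D)
    (h : N (D - ε) ≤ ENNReal.ofReal (ε ^ (-θ)) * Z) : grandQuasinorm θ D N ≤ Z := by
  rw [grandQuasinorm, if_neg hθ.not_ge]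
  exact (iInf₂_le ε hε).trans (rpow_mul_le_of_le_rpow_neg_mul hε.1 h)

/-- A near-minimizer δ of the infimum may be as large as A. If it exceeds σ it is replaced by σ: N
does not increase, and the change of weight costs at most (A/σ)^(-θ). -/
theorem exists_le_of_grandQuasinorm_lt (hN : Antitone N) (hθ : θ < 0) (hσ : 0 < σ) (hσA : σ ≤ A)
    (h : grandQuasinorm θ A N < X) :
    ∃ ε ∈ Ioc 0 σ, N (A - ε) ≤ ENNReal.ofReal (ε ^ (-θ)) * (ENNReal.ofReal ((A / σ) ^ (-θ)) * X) := by
  rw [grandQuasinorm, if_neg hθ.not_ge] at h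
  obtain ⟨δ, h⟩ := iInf_lt_iff.1 h
  obtain ⟨hδ, h⟩ := iInf_lt_iff.1 h
  have h' := le_rpow_neg_mul_of_rpow_mul_le hδ.1 h.le
  rcases le_total δ σ with hle | hle
  · refine ⟨δ, ⟨hδ.1, hle⟩, h'.trans ?_⟩
    gcongr
    refine le_mul_of_one_le_left bot_le ?_
    rw [ENNReal.one_le_ofReal]
    exact Real.one_le_rpow ((one_le_div hσ).2 hσA) (by linarith)
  · refine ⟨σ, ⟨hσ, le_rfl⟩, (hN (by linarith)).trans (h'.trans ?_)⟩
    rw [← mul_assoc, ← ENNReal.ofReal_mul (by positivity),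
      ← Real.mul_rpow hσ.le (by positivity [hσ.trans_le hσA]), mul_div_cancel₀ _ hσ.ne']
    gcongr
    · exact hδ.1.le
    · linarith
    · exact hδ.2.le

end GrandQuasinorm

/-! ### The four product estimates, by choice of shifts. -/

section GrandEstimates

/-- Needed because the infimum in a grand quasinorm with negative parameter need not be attained:
estimates are shown for every larger X' and passed to the limit. -/
theorem le_mul_of_forall_gt_le {G c X : ℝ≥0∞} (hc : c ≠ ∞) (hX : X ≠ ∞)
    (h : ∀ X' > X, X' ≠ ∞ → G ≤ c * X') : G ≤ c * X := by
  rw [mul_comm]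
  refine ENNReal.le_mul_of_forall_lt (Or.inr hc) (Or.inl hX) fun X' hX' c' hc' => ?_
  obtain ⟨Y, hXY, hY⟩ := exists_between hX'
  rw [mul_comm]
  exact (h Y hXY hY.ne_top).trans (by gcongr)

/-- At γ = 0 the definition switches to the supremum; monotonicity of N then turns one bound below D
into bounds at all exponents above D. -/
theorem grandQuasinorm_neg_le {γ D ε : ℝ} {N : ℝ → ℝ≥0∞} {Z : ℝ≥0∞} (hN : Antitone N)
    (hγ : 0 ≤ γ) (hε : ε ∈ Ioo 0 D) (h : N (D - ε) ≤ ENNReal.ofReal (ε ^ γ) * Z) :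
    grandQuasinorm (-γ) D N ≤ Z := by
  rcases hγ.eq_or_lt with rfl | hγ
  · have hle : ∀ x ∈ Ioc (0 : ℝ) 1, N (D + x) ≤ ENNReal.ofReal (x ^ (-0 : ℝ)) * Z := fun x hx => by
      have := (hN (by linarith [hx.1, hε.1] : D - ε ≤ D + x)).trans h
      simpa using this
    simpa using grandQuasinorm_le_of_nonneg hN le_rfl one_pos le_rfl hle
  · exact grandQuasinorm_le_of_neg (by linarith) hε (by simpa using h)

/-- The scale `N₀` is bounded by the product of the scales `N₁` and `N₂`, uniformly near the
exponents `D`, `A` and `B`. -/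
structure IsProductScale (A B D σ : ℝ) (K : ℝ≥0) (N₁ N₂ N₀ : ℝ → ℝ≥0∞) : Prop where
  antitone_left : Antitone N₁
  antitone_right : Antitone N₂
  antitone : Antitone N₀
  le : ∀ x ∈ Icc (-σ) σ, ∀ y ∈ Icc (-σ) σ, N₀ (D + x + y) ≤ K * N₁ (A + x) * N₂ (B + y)

theorem IsProductScale.symm {A B D σ : ℝ} {K : ℝ≥0} {N₁ N₂ N₀ : ℝ → ℝ≥0∞}
    (h : IsProductScale A B D σ K N₁ N₂ N₀) : IsProductScale B A D σ K N₂ N₁ N₀ :=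
  ⟨h.antitone_right, h.antitone_left, h.antitone, fun x hx y hy => by
    have := h.le y hy x hx
    rwa [add_right_comm, mul_right_comm]⟩

/-- The product estimate for grand quasinorms, with a constant that only depends on the
parameters of the scales. -/
def GrandProductEstimate (A B D σ : ℝ) (K : ℝ≥0) (α β γ : ℝ) : Prop :=
  ∃ C : ℝ≥0, ∀ N₁ N₂ N₀ : ℝ → ℝ≥0∞, IsProductScale A B D σ K N₁ N₂ N₀ →
    grandQuasinorm α A N₁ < ∞ → grandQuasinorm β B N₂ < ∞ →
      grandQuasinorm γ D N₀ ≤ C * grandQuasinorm α A N₁ * grandQuasinorm β B N₂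

variable {A B D σ α β γ : ℝ} {K : ℝ≥0}

theorem GrandProductEstimate.symm (h : GrandProductEstimate A B D σ K α β γ) :
    GrandProductEstimate B A D σ K β α γ := by
  obtain ⟨C, hC⟩ := h
  refine ⟨C, fun N₁ N₂ N₀ hN h₁ h₂ => ?_⟩
  rw [mul_right_comm]
  exact hC N₂ N₁ N₀ hN.symm h₂ h₁

/-- The target shift ε is split evenly between the two factors. -/
theorem grandProductEstimate_sup_sup (hσ : 0 < σ) (hσ1 : 2 * σ ≤ 1)
    (hα : 0 ≤ α) (hβ : 0 ≤ β) : GrandProductEstimate A B D σ K α β (α + β) := by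
  refine ⟨(σ ^ (-(α + β))).toNNReal * ((2 : ℝ) ^ (α + β)).toNNReal * K,
    fun N₁ N₂ N₀ hN _ _ => ?_⟩
  set X := grandQuasinorm α A N₁
  set Y := grandQuasinorm β B N₂
  have h : ∀ ε ∈ Ioc (0 : ℝ) σ, N₀ (D + ε) ≤
      ENNReal.ofReal (ε ^ (-(α + β))) * (ENNReal.ofReal (2 ^ (α + β)) * K * X * Y) := by
    intro ε hε
    have hε2 : ε / 2 ∈ Ioo (0 : ℝ) 1 := ⟨half_pos hε.1, by linarith [hε.2]⟩
    have hmem : ε / 2 ∈ Icc (-σ) σ := ⟨by linarith [hε.1], by linarith [hε.1, hε.2]⟩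
    have h0 := hN.le _ hmem _ hmem
    have hpow : (ε / 2) ^ (-α) * (ε / 2) ^ (-β) = ε ^ (-(α + β)) * 2 ^ (α + β) := by
      rw [← Real.rpow_add hε2.1, Real.div_rpow hε.1.le (by norm_num), div_eq_mul_inv,
        ← Real.rpow_neg (by norm_num)]
      ring_nf
    calc N₀ (D + ε) = N₀ (D + ε / 2 + ε / 2) := by ring_nf
      _ ≤ K * N₁ (A + ε / 2) * N₂ (B + ε / 2) := h0
      _ ≤ K * (ENNReal.ofReal ((ε / 2) ^ (-α)) * X) * (ENNReal.ofReal ((ε / 2) ^ (-β)) * Y) := by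
          gcongr
          · exact le_of_grandQuasinorm_of_nonneg hα hε2
          · exact le_of_grandQuasinorm_of_nonneg hβ hε2
      _ = ENNReal.ofReal ((ε / 2) ^ (-α) * (ε / 2) ^ (-β)) * (K * X * Y) := by
          rw [ENNReal.ofReal_mul (Real.rpow_nonneg hε2.1.le _)]
          ring
      _ = _ := by
          rw [hpow, ENNReal.ofReal_mul (Real.rpow_nonneg hε.1.le _)]
          ring
  refine (grandQuasinorm_le_of_nonneg hN.antitone (by linarith) hσ (by linarith) h).trans_eq ?_
  push_cast
  simp only [ENNReal.ofReal]
  ring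

/-- With δ a near-minimizing shift for the first factor, the second is taken at ε + δ. The powers
balance since δ^α (ε+δ)^(-(α+γ)) ≤ (ε+δ)^(-γ) ≤ ε^(-γ). Both δ and ε are kept below σ/2 so that ε +
δ ≤ σ. -/
theorem grandProductEstimate_inf_sup (hσ : 0 < σ) (hσ1 : 2 * σ < 1) (hσA : σ ≤ A)
    (hα : 0 < α) (hγ : 0 ≤ γ) : GrandProductEstimate A B D σ K (-α) (α + γ) γ := by
  refine ⟨((σ / 2) ^ (-γ)).toNNReal * K * ((A / (σ / 2)) ^ α).toNNReal,
    fun N₁ N₂ N₀ hN h₁ h₂ => ?_⟩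
  set Y := grandQuasinorm (α + γ) B N₂
  rw [mul_right_comm]
  refine le_mul_of_forall_gt_le (ENNReal.mul_ne_top ENNReal.coe_ne_top h₂.ne) h₁.ne fun X hX _ => ?_
  obtain ⟨δ, hδ, hδX⟩ := exists_le_of_grandQuasinorm_lt (σ := σ / 2) hN.antitone_left
    (by linarith) (by linarith) (by linarith) hX
  rw [neg_neg] at hδX
  set c := ENNReal.ofReal ((A / (σ / 2)) ^ α)
  have h : ∀ ε ∈ Ioc (0 : ℝ) (σ / 2), N₀ (D + ε) ≤
      ENNReal.ofReal (ε ^ (-γ)) * (K * (c * X) * Y) := by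
    intro ε hε
    have hsum : 0 < ε + δ := add_pos hε.1 hδ.1
    have hs : ε + δ ∈ Ioo (0 : ℝ) 1 := ⟨hsum, by linarith [hε.2, hδ.2]⟩
    have h0 := hN.le (-δ) ⟨by linarith [hδ.2], by linarith [hδ.1]⟩ (ε + δ)
      ⟨by linarith, by linarith [hε.2, hδ.2]⟩
    have hpow : δ ^ α * (ε + δ) ^ (-(α + γ)) ≤ ε ^ (-γ) := by
      calc δ ^ α * (ε + δ) ^ (-(α + γ)) ≤ (ε + δ) ^ α * (ε + δ) ^ (-(α + γ)) := by
            have hδ0 := hδ.1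
            have hε0 := hε.1
            gcongr
            linarith
        _ = (ε + δ) ^ (-γ) := by
            rw [← Real.rpow_add hsum]
            ring_nf
        _ ≤ ε ^ (-γ) :=
            Real.rpow_le_rpow_of_nonpos hε.1 (by linarith [hδ.1]) (by linarith)
    calc N₀ (D + ε) = N₀ (D + -δ + (ε + δ)) := by ring_nf
      _ ≤ K * N₁ (A + -δ) * N₂ (B + (ε + δ)) := h0
      _ ≤ K * (ENNReal.ofReal (δ ^ α) * (c * X)) *
            (ENNReal.ofReal ((ε + δ) ^ (-(α + γ))) * Y) := by
          gcongr
          · exact hδX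
          · exact le_of_grandQuasinorm_of_nonneg (by linarith) hs
      _ = ENNReal.ofReal (δ ^ α * (ε + δ) ^ (-(α + γ))) * (K * (c * X) * Y) := by
          rw [ENNReal.ofReal_mul (Real.rpow_nonneg hδ.1.le _)]
          ring
      _ ≤ _ := by gcongr
  refine (grandQuasinorm_le_of_nonneg hN.antitone hγ (by linarith) (by linarith) h).trans_eq ?_
  push_cast
  simp only [c, ENNReal.ofReal]
  ring

/-- With η a near-minimizing shift for the second factor, the first is taken at +η/2. The net shift
-η/2 is a competitor for the infimum on the left, and all powers are those of η. -/
theorem grandProductEstimate_sup_inf (hσ : 0 < σ) (hσ1 : 2 * σ < 1) (hσB : σ ≤ B)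
    (hσD : σ < D) (hα : 0 ≤ α) (hγ : 0 ≤ γ) (hβ : 0 < γ + α) :
    GrandProductEstimate A B D σ K α (-(γ + α)) (-γ) := by
  refine ⟨K * ((2 : ℝ) ^ (γ + α)).toNNReal * ((B / σ) ^ (γ + α)).toNNReal,
    fun N₁ N₂ N₀ hN h₁ h₂ => ?_⟩
  set X := grandQuasinorm α A N₁
  refine le_mul_of_forall_gt_le (ENNReal.mul_ne_top ENNReal.coe_ne_top h₁.ne) h₂.ne fun Y hY _ => ?_
  obtain ⟨η, hη, hηY⟩ := exists_le_of_grandQuasinorm_lt (σ := σ) hN.antitone_right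
    (by linarith) hσ hσB hY
  rw [neg_neg] at hηY
  set c := ENNReal.ofReal ((B / σ) ^ (γ + α))
  have hη0 := hη.1
  have hη2 : 0 < η / 2 := half_pos hη.1
  refine grandQuasinorm_neg_le (ε := η / 2) hN.antitone hγ ⟨hη2, by linarith [hη.2]⟩ ?_
  have h0 := hN.le (η / 2) ⟨by linarith, by linarith [hη.2]⟩ (-η)
    ⟨by linarith [hη.2], by linarith⟩
  have hpow : (η / 2) ^ (-α) * η ^ (γ + α) = (η / 2) ^ γ * 2 ^ (γ + α) := by
    have : η = η / 2 * 2 := by ring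
    nth_rewrite 2 [this]
    rw [Real.mul_rpow hη2.le (by norm_num), ← mul_assoc, ← Real.rpow_add hη2]
    ring_nf
  calc N₀ (D - η / 2) = N₀ (D + η / 2 + -η) := by ring_nf
    _ ≤ K * N₁ (A + η / 2) * N₂ (B + -η) := h0
    _ ≤ K * (ENNReal.ofReal ((η / 2) ^ (-α)) * X) *
          (ENNReal.ofReal (η ^ (γ + α)) * (c * Y)) := by
        gcongr
        · exact le_of_grandQuasinorm_of_nonneg hα ⟨hη2, by linarith [hη.2]⟩
        · exact hηY
    _ = ENNReal.ofReal ((η / 2) ^ (-α) * η ^ (γ + α)) * (K * X * (c * Y)) := by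
        rw [ENNReal.ofReal_mul (Real.rpow_nonneg hη2.le _)]
        ring
    _ = _ := by
        rw [hpow, ENNReal.ofReal_mul (Real.rpow_nonneg hη2.le _)]
        push_cast
        simp only [c, ENNReal.ofReal]
        ring

/-- The near-minimizing shifts δ and η add up, and δ^α η^β ≤ (δ+η)^(α+β). The condition 2σ < D makes
δ + η admissible. -/
theorem grandProductEstimate_inf_inf (hσ : 0 < σ) (hσA : σ ≤ A) (hσB : σ ≤ B)
    (hσD : 2 * σ < D) (hα : 0 < α) (hβ : 0 < β) :
    GrandProductEstimate A B D σ K (-α) (-β) (-(α + β)) := by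
  refine ⟨K * ((A / σ) ^ α).toNNReal * ((B / σ) ^ β).toNNReal, fun N₁ N₂ N₀ hN h₁ h₂ => ?_⟩
  refine le_mul_of_forall_gt_le (ENNReal.mul_ne_top ENNReal.coe_ne_top h₁.ne) h₂.ne fun Y hY hYtop => ?_
  rw [mul_right_comm]
  refine le_mul_of_forall_gt_le (ENNReal.mul_ne_top ENNReal.coe_ne_top hYtop) h₁.ne fun X hX _ => ?_
  obtain ⟨δ, hδ, hδX⟩ := exists_le_of_grandQuasinorm_lt (σ := σ) hN.antitone_left
    (by linarith) hσ hσA hX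
  obtain ⟨η, hη, hηY⟩ := exists_le_of_grandQuasinorm_lt (σ := σ) hN.antitone_right
    (by linarith) hσ hσB hY
  rw [neg_neg] at hδX hηY
  set c := ENNReal.ofReal ((A / σ) ^ α)
  set d := ENNReal.ofReal ((B / σ) ^ β)
  have hδ0 := hδ.1
  have hη0 := hη.1
  refine grandQuasinorm_neg_le (ε := δ + η) hN.antitone (by linarith)
    ⟨by linarith, by linarith [hδ.2, hη.2]⟩ ?_
  have h0 := hN.le (-δ) ⟨by linarith [hδ.2], by linarith⟩ (-η) ⟨by linarith [hη.2], by linarith⟩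
  have hpow : δ ^ α * η ^ β ≤ (δ + η) ^ (α + β) := by
    rw [Real.rpow_add (by linarith)]
    gcongr <;> linarith
  calc N₀ (D - (δ + η)) = N₀ (D + -δ + -η) := by ring_nf
    _ ≤ K * N₁ (A + -δ) * N₂ (B + -η) := h0
    _ ≤ K * (ENNReal.ofReal (δ ^ α) * (c * X)) * (ENNReal.ofReal (η ^ β) * (d * Y)) := by
        gcongr
        · exact hδX
        · exact hηY
    _ = ENNReal.ofReal (δ ^ α * η ^ β) * (K * (c * X) * (d * Y)) := by
        rw [ENNReal.ofReal_mul (Real.rpow_nonneg hδ.1.le _)]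
        ring
    _ ≤ ENNReal.ofReal ((δ + η) ^ (α + β)) * (K * (c * X) * (d * Y)) := by gcongr
    _ = _ := by
        push_cast
        simp only [c, d, ENNReal.ofReal]
        ring

/-- The four product estimates for grand quasinorms. -/
theorem grandProductEstimates (hσ : 0 < σ) (hσ1 : 2 * σ < 1) (hσA : σ ≤ A) (hσB : σ ≤ B)
    (hσD : 2 * σ < D) {θ θ₀ θ₁ : ℝ} (hθ : 0 ≤ θ) (hθ₀ : 0 ≤ θ₀) (hθ₁ : 0 ≤ θ₁) :
    (θ = θ₁ + θ₀ →
      GrandProductEstimate A B D σ K (-θ₀) θ θ₁ ∧ GrandProductEstimate A B D σ K θ₀ (-θ) (-θ₁)) ∧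
    (θ = θ₁ - θ₀ →
      GrandProductEstimate A B D σ K θ₀ θ θ₁ ∧
      GrandProductEstimate A B D σ K (-θ₀) (-θ) (-θ₁)) := by
  have h00 : GrandProductEstimate A B D σ K 0 0 0 := by
    simpa using grandProductEstimate_sup_sup (A := A) (B := B) (D := D) (K := K) hσ hσ1.le
      le_rfl le_rfl
  refine ⟨fun h => ⟨?_, ?_⟩, fun h => ⟨?_, ?_⟩⟩
  · rcases hθ₀.eq_or_lt with rfl | hpos
    · have := grandProductEstimate_sup_sup (A := A) (B := B) (D := D) (K := K) hσ hσ1.le le_rfl hθ₁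
      simpa [h] using this
    · rw [h, add_comm]
      exact grandProductEstimate_inf_sup hσ hσ1 hσA hpos hθ₁
  · rcases hθ.eq_or_lt with rfl | hpos
    · have h0 : θ₀ = 0 := by linarith
      have h1 : θ₁ = 0 := by linarith
      simpa [h0, h1] using h00
    · rw [h]
      exact grandProductEstimate_sup_inf hσ hσ1 hσB (by linarith) hθ₀ hθ₁ (by linarith)
  · obtain rfl : θ₁ = θ₀ + θ := by linarith
    exact grandProductEstimate_sup_sup hσ hσ1.le hθ₀ hθ
  · obtain rfl : θ₁ = θ₀ + θ := by linarith
    rcases hθ₀.eq_or_lt with rfl | hpos₀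
    · rcases hθ.eq_or_lt with rfl | hpos
      · simpa using h00
      · have := grandProductEstimate_sup_inf (A := A) (D := D) (K := K) hσ hσ1 hσB (by linarith)
          le_rfl hθ (by linarith)
        simpa using this
    · rcases hθ.eq_or_lt with rfl | hpos
      · have := (grandProductEstimate_sup_inf (A := B) (D := D) (K := K) hσ hσ1 hσA (by linarith)
          le_rfl hθ₀ (by linarith)).symm
        simpa using this
      · exact grandProductEstimate_inf_inf hσ hσA hσB hσD hpos₀ hpos

end GrandEstimates

/-! ### Transfer from abstract scales to convolutions on Ω. -/

section GrandLorentz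

variable {n : ℕ} {Ω : Set (EuclideanSpace ℝ (Fin n))}

theorem grandLorentzNorm_eq_grandQuasinorm {p : ℝ} (hp : 0 < p) (θ : ℝ) (q : ℝ≥0∞)
    (f : EuclideanSpace ℝ (Fin n) → ℝ) :
    grandLorentzNorm Ω θ (ENNReal.ofReal p) q f =
      grandQuasinorm θ (1 / p) (lorentzQuasinorm volume Ω q fun x => ‖f x‖ₑ) := by
  have : (ENNReal.ofReal p)⁻¹.toReal = 1 / p := by
    rw [ENNReal.toReal_inv, ENNReal.toReal_ofReal hp.le, one_div]
  rw [← this]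
  rfl

/-- True for every y because x ↦ y - x preserves null sets. Hence passing to measurable
representatives leaves f * g unchanged at every point. -/
theorem convOn_congr_ae (hΩ : MeasurableSet Ω) {f f' g g' : EuclideanSpace ℝ (Fin n) → ℝ}
    (hf : f =ᵐ[volume.restrict Ω] f') (hg : g =ᵐ[volume.restrict Ω] g')
    (y : EuclideanSpace ℝ (Fin n)) :
    (fun x => f x * Ω.indicator g (y - x)) =ᵐ[volume.restrict Ω]
      fun x => f' x * Ω.indicator g' (y - x) := by
  have hg' : Ω.indicator g =ᵐ[volume] Ω.indicator g' :=
    (ae_eq_restrict_iff_indicator_ae_eq hΩ).1 hg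
  have h2 := (Measure.measurePreserving_sub_left volume y).quasiMeasurePreserving.ae hg'
  filter_upwards [hf, ae_restrict_of_ae h2] with x hx hx2
  rw [hx, hx2]

theorem setLIntegral_enorm_mul_eq_lconv (hΩ : MeasurableSet Ω)
    (f g : EuclideanSpace ℝ (Fin n) → ℝ) (y : EuclideanSpace ℝ (Fin n)) :
    ∫⁻ x in Ω, ‖f x * Ω.indicator g (y - x)‖ₑ =
      lconv volume (Ω.indicator fun x => ‖f x‖ₑ) (Ω.indicator fun x => ‖g x‖ₑ) y := by
  rw [lconv, ← lintegral_indicator hΩ]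
  refine lintegral_congr fun x => ?_
  by_cases hx : x ∈ Ω
  · by_cases hy : y - x ∈ Ω <;> simp [hx, hy, enorm_mul]
  · simp [hx]

theorem measurable_mul_indicator_sub (hΩ : MeasurableSet Ω)
    {f g : EuclideanSpace ℝ (Fin n) → ℝ} (hf : Measurable f) (hg : Measurable g) :
    Measurable fun z : EuclideanSpace ℝ (Fin n) × EuclideanSpace ℝ (Fin n) =>
      f z.2 * Ω.indicator g (z.1 - z.2) :=
  (hf.comp measurable_snd).mul ((hg.indicator hΩ).comp (measurable_fst.sub measurable_snd))

/-- An estimate between the abstract grand quasinorms gives the estimate for convolutions. -/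
theorem GrandProductEstimate.grandConvEstimate (hΩ : MeasurableSet Ω) (hΩ' : volume Ω ≠ ∞)
    {p q r σ : ℝ} (hp : 0 < p) (hq : 0 < q) (hr : 0 < r) {τ : ℝ≥0∞} (hτ : 0 < τ) {K : ℝ≥0}
    (hK : ∀ u v : EuclideanSpace ℝ (Fin n) → ℝ≥0∞, Measurable u → Measurable v →
      ∀ x ∈ Icc (-σ) σ, ∀ y ∈ Icc (-σ) σ,
        lorentzQuasinorm volume Ω τ (lconv volume (Ω.indicator u) (Ω.indicator v))
          (1 / q + x + y) ≤ K * lorentzQuasinorm volume Ω τ u (1 / p + x) *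
            lorentzQuasinorm volume Ω ∞ v (1 / r + y)) {α β γ : ℝ}
    (h : GrandProductEstimate (1 / p) (1 / r) (1 / q) σ K α β γ) :
    GrandConvEstimate Ω p q r τ α β γ := by
  obtain ⟨C, hC⟩ := h
  -- Adding 1 secures a positive constant.
  refine ⟨C + 1, by positivity, fun f g hf hg => ?_⟩
  obtain ⟨hfm, hf⟩ := hf
  obtain ⟨hgm, hg⟩ := hg
  simp only [MemGrandLorentz, grandLorentzNorm_eq_grandQuasinorm hp,
    grandLorentzNorm_eq_grandQuasinorm hr, grandLorentzNorm_eq_grandQuasinorm hq] at hf hg ⊢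
  set f' := hfm.mk f
  set g' := hgm.mk g
  have hf'm : Measurable f' := hfm.measurable_mk
  have hg'm : Measurable g' := hgm.measurable_mk
  have hff' : f =ᵐ[volume.restrict Ω] f' := hfm.ae_eq_mk
  have hgg' : g =ᵐ[volume.restrict Ω] g' := hgm.ae_eq_mk
  have hcongr := convOn_congr_ae hΩ hff' hgg'
  have hconv : convOn Ω f g = convOn Ω f' g' := funext fun y => integral_congr_ae (hcongr y)
  rw [lorentzQuasinorm_congr_ae (u := fun x => ‖f x‖ₑ) (v := fun x => ‖f' x‖ₑ)
    (by filter_upwards [hff'] with x hx; rw [hx])] at hf ⊢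
  rw [lorentzQuasinorm_congr_ae (u := fun x => ‖g x‖ₑ) (v := fun x => ‖g' x‖ₑ)
    (by filter_upwards [hgg'] with x hx; rw [hx])] at hg ⊢
  rw [hconv]
  set u : EuclideanSpace ℝ (Fin n) → ℝ≥0∞ := fun x => ‖f' x‖ₑ
  set v : EuclideanSpace ℝ (Fin n) → ℝ≥0∞ := fun x => ‖g' x‖ₑ
  have hu : Measurable u := hf'm.enorm
  have hv : Measurable v := hg'm.enorm
  set w := lconv volume (Ω.indicator u) (Ω.indicator v)
  have hmain := hC (lorentzQuasinorm volume Ω τ u) (lorentzQuasinorm volume Ω ∞ v)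
    (lorentzQuasinorm volume Ω τ w) ⟨lorentzQuasinorm_antitone, lorentzQuasinorm_antitone,
      lorentzQuasinorm_antitone, hK u v hu hv⟩ hf hg
  have hfin : grandQuasinorm γ (1 / q) (lorentzQuasinorm volume Ω τ w) < ∞ :=
    hmain.trans_lt (ENNReal.mul_lt_top (ENNReal.mul_lt_top ENNReal.coe_lt_top hf) hg)
  have hle : grandQuasinorm γ (1 / q) (lorentzQuasinorm volume Ω τ fun x => ‖convOn Ω f' g' x‖ₑ) ≤
      grandQuasinorm γ (1 / q) (lorentzQuasinorm volume Ω τ w) := by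
    refine grandQuasinorm_mono fun a => lorentzQuasinorm_mono fun y => ?_
    exact (enorm_integral_le_lintegral_enorm _).trans_eq
      (setLIntegral_enorm_mul_eq_lconv hΩ f' g' y)
  have hmeas := measurable_mul_indicator_sub hΩ hf'm hg'm
  refine ⟨?_, ⟨?_, hle.trans_lt hfin⟩, hle.trans (hmain.trans ?_)⟩
  -- Finiteness of the functional of |f| * |g| at a single exponent suffices for convergence almost
  -- everywhere.
  · obtain ⟨a, ha⟩ := exists_lt_top_of_grandQuasinorm_lt_top hfin
    filter_upwards [ae_lt_top_of_lorentzQuasinorm_lt_top hτ hΩ' ha] with y hy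
    refine Integrable.congr ⟨?_, ?_⟩ (hcongr y).symm
    · exact (hmeas.comp measurable_prodMk_left).aestronglyMeasurable
    · rw [HasFiniteIntegral, setLIntegral_enorm_mul_eq_lconv hΩ f' g' y]
      exact hy
  · exact (StronglyMeasurable.integral_prod_right'
      (ν := volume.restrict Ω) hmeas.stronglyMeasurable).measurable.aemeasurable
  · gcongr
    simp

end GrandLorentz

/-! ### The O'Neil-type inequality. -/

theorem theoremO {n : ℕ} (Ω : Set (EuclideanSpace ℝ (Fin n))) (hΩ : MeasurableSet Ω)
    (hΩfin : volume Ω < ∞) (p q r : ℝ) (hp : 1 < p) (hpq : p < q)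
    (hr : 1 / r = 1 + 1 / q - 1 / p) (τ : ℝ≥0∞) (hτ : 0 < τ)
    (θ θ₀ θ₁ : ℝ) (hθ : 0 ≤ θ) (hθ₀ : 0 ≤ θ₀) (hθ₁ : 0 ≤ θ₁) :
    (θ = θ₁ + θ₀ →
      GrandConvEstimate Ω p q r τ (-θ₀) θ θ₁ ∧
      GrandConvEstimate Ω p q r τ θ₀ (-θ) (-θ₁)) ∧
    (θ = θ₁ - θ₀ →
      GrandConvEstimate Ω p q r τ θ₀ θ θ₁ ∧
      GrandConvEstimate Ω p q r τ (-θ₀) (-θ) (-θ₁)) := by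
  have hp0 : 0 < p := by linarith
  have hq0 : 0 < q := by linarith
  have hp1 : 1 / p < 1 := (div_lt_one hp0).2 hp
  have hq1 : 0 < 1 / q := by positivity
  have hqp : 1 / q < 1 / p := one_div_lt_one_div_of_lt hp0 hpq
  have hr1 : 0 < 1 / r := by linarith
  have hr0 : 0 < r := one_div_pos.1 hr1
  -- The three gaps are positive since p > 1, r > 1 (from q > p) and q < ∞. With 4σ below each,
  -- shifts of size up to σ keep 1/p + x and 1/r + y at most 1 - σ, and 1/q + x + y at least σ.
  obtain ⟨σ, hσ, hσp, hσr, hσq⟩ : ∃ σ : ℝ, 0 < σ ∧ 4 * σ ≤ 1 - 1 / p ∧ 4 * σ ≤ 1 - 1 / r ∧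
      4 * σ ≤ 1 / q := by
    refine ⟨min (1 - 1 / p) (min (1 - 1 / r) (1 / q)) / 4, ?_, ?_, ?_, ?_⟩
    · have : 0 < min (1 - 1 / p) (min (1 - 1 / r) (1 / q)) :=
        lt_min (by linarith) (lt_min (by linarith) hq1)
      linarith
    · linarith [min_le_left (1 - 1 / p) (min (1 - 1 / r) (1 / q))]
    · linarith [min_le_right (1 - 1 / p) (min (1 - 1 / r) (1 / q)),
        min_le_left (1 - 1 / r) (1 / q)]
    · linarith [min_le_right (1 - 1 / p) (min (1 - 1 / r) (1 / q)),
        min_le_right (1 - 1 / r) (1 / q)]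
  obtain ⟨K, hK⟩ := exists_lorentzQuasinorm_lconv_le hΩ hΩfin.ne hτ hσ
  have hK' : ∀ u v : EuclideanSpace ℝ (Fin n) → ℝ≥0∞, Measurable u → Measurable v →
      ∀ x ∈ Icc (-σ) σ, ∀ y ∈ Icc (-σ) σ,
        lorentzQuasinorm volume Ω τ (lconv volume (Ω.indicator u) (Ω.indicator v))
          (1 / q + x + y) ≤ K * lorentzQuasinorm volume Ω τ u (1 / p + x) *
            lorentzQuasinorm volume Ω ∞ v (1 / r + y) := by
    intro u v hu hv x hx y hy
    have h := hK u v hu hv (1 / p + x) (1 / r + y) (by linarith [hx.2]) (by linarith [hy.2])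
      (by linarith [hx.1, hy.1])
    rwa [show 1 / p + x + (1 / r + y) - 1 = 1 / q + x + y by linarith] at h
  have key := grandProductEstimates (A := 1 / p) (B := 1 / r) (D := 1 / q) (K := K) hσ
    (by linarith) (by linarith) (by linarith) (by linarith) hθ hθ₀ hθ₁
  have transfer : ∀ {α β γ : ℝ}, GrandProductEstimate (1 / p) (1 / r) (1 / q) σ K α β γ →
      GrandConvEstimate Ω p q r τ α β γ := fun h =>
    h.grandConvEstimate hΩ hΩfin.ne hp0 hq0 hr0 hτ hK'
  exact ⟨fun h => ⟨transfer (key.1 h).1, transfer (key.1 h).2⟩,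
    fun h => ⟨transfer (key.2 h).1, transfer (key.2 h).2⟩⟩
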